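/- Let $z$ be an indeterminate and $k\ge 1$ an integer. For $n\ge1$ let $$P_k(x_1,\dots,x_n;z)=\sum_{i=1}^n x_i^k\prod_{j\ne i}\frac{x_i-zx_j}{x_i-x_j}$$ be the one-row Hall–Littlewood polynomial, let $J_i=\sum_{j<i}(j\,i)$, $1\le i\le n$, be the (commuting) Jucys–Murphy elements of $\mathbb C[S_n]$, and for $\mu\vdash n$ let $C_\mu$ be the formal sum of the permutations in $S_n$ of cycle type $\mu$. For a partition $\rho$ denote by $|\rho|$ its weight, $l(\rho)$ its number of parts, $m_1(\rho)$ its number of parts equal to $1$, $\overline\rho$ the partition obtained by erasing all parts $1$, and, if $|\rho|\le n$, $\tilde\rho=\rho\cup 1^{n-|\rho|}$. Then there are polynomials $c^{(k)}_\rho\in\mathbb C[z]$, indexed by all partitions $\rho$ and independent of $n$, such that for every $n\ge 1$ $$P_k(J_1,\dots,J_n;z)=\sum_{|\rho|\le n}c^{(k)}_\rho\binom{n-|\overline\rho|}{m_1(\rho)}\,C_{\tilde\rho}.$$ For any such family, if $|\rho|-l(\rho)=k$ and $m_1(\rho)=0$, then $$c^{(k)}_\rho=(1-z)^{l(\rho)-1}\prod_{i=1}^{l(\rho)}\mathcal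 C(\rho_i-1),$$ where $$\mathcal C(r)=\sum_{m=0}^{r}z^{r-m}(1-z)^m\binom{r+m}{r-m}\frac1{m+1}\binom{2m}{m}.$$ -/

import Mathlib

open Polynomial

noncomputable section

namespace HallLittlewoodClass

/-- The parameter `z`, an indeterminate over `ℂ`. -/
abbrev z : ℂ[X] := X

/-- The field of rational functions in `x₀, …, x_{n-1}` (and `z`). -/
abbrev RatFun (n : ℕ) : Type := FractionRing (MvPolynomial (Fin n) ℂ[X])

/-- The variable `x i` as a rational function. -/
def x (n : ℕ) (i : Fin n) : RatFun n :=
  algebraMap (MvPolynomial (Fin n) ℂ[X]) (RatFun n) (MvPolynomial.X i)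

/-- The parameter `z` as a rational function. -/
def zz (n : ℕ) : RatFun n :=
  algebraMap (MvPolynomial (Fin n) ℂ[X]) (RatFun n) (MvPolynomial.C z)

/-- The Hall-Littlewood function `P_l(x₀, …, x_{n-1}; z)` of a partition `l` with at most `n`
parts (padded with zeros to `n` entries), as a rational function:
the sum over `w ∈ S_n / S_n^l` of `w (x^l ∏_{l_i > l_j} (x_i - z x_j) / (x_i - x_j))`, where
`S_n^l` is the stabilizer of `l`. The cosets are listed by the distinct rearrangements `a` of `l`.
Each factor is a quotient by the nonzero element `x_i - x_j`, `i ≠ j`. -/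
def hallLittlewood (n : ℕ) (l : Fin n → ℕ) : RatFun n :=
  ∑ a ∈ Finset.univ.image (fun w : Equiv.Perm (Fin n) => l ∘ w),
    (∏ i, x n i ^ a i) *
      ∏ i, ∏ j, if a j < a i then (x n i - zz n * x n j) / (x n i - x n j) else 1

/-- The one-row partition `(k) = (k, 0, …, 0)` with `n` entries. -/
def row (n k : ℕ) : Fin n → ℕ := fun i => if (i : ℕ) = 0 then k else 0

/-- The group algebra of `S_n` with coefficients in `ℂ[z]`. -/
abbrev GroupAlg (n : ℕ) : Type := MonoidAlgebra ℂ[X] (Equiv.Perm (Fin n))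

/-- The Jucys-Murphy element `J_i = ∑_{j < i} (j i)`. -/
def jucysMurphy (n : ℕ) (i : Fin n) : GroupAlg n :=
  ∑ j ∈ Finset.univ.filter (fun j => j < i), MonoidAlgebra.of ℂ[X] _ (Equiv.swap j i)

/-- The specialization `P(J_1, …, J_n)` of a polynomial `P`. The powers of the (commuting)
Jucys-Murphy elements in each monomial are multiplied in increasing order of the index. -/
def evalJM {n : ℕ} (P : MvPolynomial (Fin n) ℂ[X]) : GroupAlg n :=
  ∑ e ∈ P.support, P.coeff e • (List.ofFn (fun i => jucysMurphy n i ^ e i)).prod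

/-- The formal sum `C_μ` of the permutations in `S_n` of cycle type `μ`; here `μ` is a multiset of
parts which includes the fixed points as parts `1`. -/
def classSum (n : ℕ) (μ : Multiset ℕ) : GroupAlg n :=
  ∑ σ ∈ Finset.univ.filter (fun σ : Equiv.Perm (Fin n) => σ.partition.parts = μ),
    MonoidAlgebra.of ℂ[X] _ σ

/-- `m_i(ρ)`, the multiplicity of the part `i`. -/
def mult {m : ℕ} (i : ℕ) (ρ : m.Partition) : ℕ := ρ.parts.count i

/-- `l(ρ)`, the number of parts. -/
def len {m : ℕ} (ρ : m.Partition) : ℕ := Multiset.card ρ.parts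

/-- The weight of the partition obtained by erasing all parts `1` of `ρ`. -/
def reducedWeight {m : ℕ} (ρ : m.Partition) : ℕ := (ρ.parts.filter (fun i => i ≠ 1)).sum

/-- The parts of `ρ ∪ 1^{n-|ρ|}`, for `|ρ| = m ≤ n`. -/
def padOnes {m : ℕ} (n : ℕ) (ρ : m.Partition) : Multiset ℕ :=
  ρ.parts + Multiset.replicate (n - m) 1

/-- A family `c` of polynomials in `z`, indexed by all partitions and not depending on `n`, gives
the class expansion of the one-row Hall-Littlewood function `P_k`, when for every `n ≥ 1`, with
`P_k(x_1, …, x_n; z)` a polynomial `P`,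
`P(J_1, …, J_n) = ∑_{|ρ| ≤ n} c_ρ * binom(n - reducedWeight ρ, m_1(ρ)) * C_{ρ ∪ 1^{n-|ρ|}}`. -/
def IsClassExpansion (k : ℕ) (c : (m : ℕ) → m.Partition → ℂ[X]) : Prop :=
  ∀ n : ℕ, 1 ≤ n → ∃ P : MvPolynomial (Fin n) ℂ[X],
    algebraMap (MvPolynomial (Fin n) ℂ[X]) (RatFun n) P = hallLittlewood n (row n k) ∧
    evalJM P = ∑ m ∈ Finset.range (n + 1), ∑ ρ : m.Partition,
      (c m ρ * ((n - reducedWeight ρ).choose (mult 1 ρ) : ℂ[X])) • classSum n (padOnes n ρ)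

/-- The generalized Catalan polynomial
`∑_{m=0}^r z^{r-m} (1-z)^m binom(r+m, r-m) (1/(m+1)) binom(2m, m)`. -/
def genCatalan (r : ℕ) : ℂ[X] :=
  ∑ m ∈ Finset.range (r + 1),
    z ^ (r - m) * (1 - z) ^ m * ((r + m).choose (r - m) : ℂ[X]) *
      C (1 / ((m : ℂ) + 1) * ((2 * m).choose m : ℂ))

end HallLittlewoodClass

end

/-! Let `R(X) = ∏ (1 - z x_i X) / (1 - x_i X)`. By partial fractions its coefficient at `X^k`, `k ≥
1`, is `(1 - z) P_k`. This identifies `P_k` with the polynomial `rowPoly` (`algebraMap_rowPoly`) and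
makes `(1 - z) P_k(J_1, …, J_n)` a coefficient of `ratioProd`.

Existence: by Jucys' factorization (`coeff_linearProd`) the products `∏ (1 - q J_i X)` have central
coefficients, hence so has the quotient of two of them. The coefficient at `σ` then depends only on
`n` and the cycle type. With the nontrivial cycles held fixed, it is a function of the number of
fixed points, and Newton's forward difference formula produces the binomials.

Formula: for `ρ` without parts `1`, taking `n = |ρ|` isolates `c_ρ`. The condition `|ρ| - l(ρ) = k`
says that `σ` needs `k` transpositions, the most that degree `k` allows. Clearing the denominator `1
- J_m X` gives a recursion whose extremal part only cuts the cycle through `m` into two. The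
resulting convolution is solved by the weight `(1 - z) 𝒞(l - 1)` for each cycle of length `l ≥ 2`
(`cycleWeight_recursion`, `coeff_reflLength_ratioProd`), and one factor `1 - z` cancels. -/

noncomputable section

namespace HallLittlewoodClass

/-! ### Generalized Catalan polynomials and the recursion for cycle weights. -/

section GenCatalan

open PowerSeries in
theorem mk_pow_mul_one_sub {R : Type*} [CommRing R] (a : R) :
    PowerSeries.mk (fun n => a ^ n) * (1 - PowerSeries.C a * PowerSeries.X) = 1 := by
  ext n
  rw [mul_sub, mul_one, map_sub, ← mul_assoc, mul_comm _ (PowerSeries.C a), mul_assoc,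
    PowerSeries.coeff_C_mul]
  cases n with
  | zero => simp
  | succ n => simp [PowerSeries.coeff_succ_mul_X, PowerSeries.coeff_one, pow_succ']

theorem coeff_mk_pow_pow_succ {R : Type*} [CommRing R] (a : R) (d n : ℕ) :
    PowerSeries.coeff n (PowerSeries.mk (fun n => a ^ n) ^ (d + 1)) =
      a ^ n * ((d + n).choose d : R) := by
  have h : PowerSeries.mk (fun n => a ^ n) = PowerSeries.rescale a (PowerSeries.mk 1) := by
    ext n; simp [PowerSeries.coeff_rescale]
  rw [h, ← map_pow, PowerSeries.mk_one_pow_eq_mk_choose_add, PowerSeries.coeff_rescale,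
    PowerSeries.coeff_mk]

theorem genCatalan_eq_sum_catalan (r : ℕ) :
    genCatalan r = ∑ m ∈ Finset.range (r + 1),
      (catalan m : ℂ[X]) * ((1 - z) ^ m * (z ^ (r - m) * ((r + m).choose (2 * m) : ℂ[X]))) := by
  refine Finset.sum_congr rfl fun m hm => ?_
  have hm' : m ≤ r := Nat.lt_succ_iff.mp (Finset.mem_range.mp hm)
  have h1 : (r + m).choose (r - m) = (r + m).choose (2 * m) :=
    Nat.choose_symm_of_eq_add (by omega)
  have h2 : (1 / ((m : ℂ) + 1) * ((2 * m).choose m : ℂ)) = (catalan m : ℂ) := by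
    have h := succ_mul_catalan_eq_centralBinom m
    have h' : ((m : ℂ) + 1) * (catalan m : ℂ) = ((2 * m).choose m : ℂ) := by
      rw [← Nat.centralBinom_eq_two_mul_choose, ← h]; push_cast; ring
    rw [← h']
    have : (m : ℂ) + 1 ≠ 0 := by exact_mod_cast Nat.succ_ne_zero m
    field_simp
  rw [h1, h2, Polynomial.C_eq_natCast]
  ring

/-- The series `(1 - z X)⁻¹ c(t X / (1 - z X) ^ 2)`, where `c` is the Catalan series. -/
def catalanTransform {R : Type*} [CommRing R] (z t : R) : PowerSeries R :=
  PowerSeries.mk (fun n => z ^ n) *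
    (PowerSeries.map (Nat.castRingHom R) PowerSeries.catalanSeries).subst
      (PowerSeries.C t * PowerSeries.X * PowerSeries.mk (fun n => z ^ n) ^ 2)

theorem coeff_catalanTransform {R : Type*} [CommRing R] (z t : R) (r : ℕ) :
    PowerSeries.coeff r (catalanTransform z t) = ∑ m ∈ Finset.range (r + 1),
      (catalan m : R) * (t ^ m * (z ^ (r - m) * ((r + m).choose (2 * m) : R))) := by
  rw [catalanTransform]
  set D : PowerSeries R := PowerSeries.mk (fun n => z ^ n) with hD
  set s : PowerSeries R := PowerSeries.C t * PowerSeries.X * D ^ 2 with hs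
  set c := PowerSeries.map (Nat.castRingHom R) PowerSeries.catalanSeries with hc
  have hsub : PowerSeries.HasSubst s :=
    PowerSeries.HasSubst.of_constantCoeff_zero' (by simp [hs])
  have hsplit := PowerSeries.eq_shift_mul_X_pow_add_trunc (r + 1) c
  -- The tail of the Catalan series yields a multiple of `s ^ (r + 1)`, hence of `X ^ (r + 1)`, and
  -- does not reach degree `r`.
  have h3 : c.subst s = (PowerSeries.mk fun i => PowerSeries.coeff (i + (r + 1)) c).subst s *
      s ^ (r + 1) + ∑ m ∈ Finset.range (r + 1), PowerSeries.C (catalan m : R) * s ^ m := by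
    conv_lhs => rw [hsplit]
    rw [PowerSeries.subst_add hsub, PowerSeries.subst_mul hsub, PowerSeries.subst_pow hsub,
      PowerSeries.subst_X hsub, PowerSeries.subst_coe hsub, PowerSeries.trunc_apply]
    congr 1
    rw [map_sum, Nat.Ico_zero_eq_range]
    refine Finset.sum_congr rfl fun m _ => ?_
    rw [Polynomial.aeval_monomial, hc]
    simp [PowerSeries.algebraMap_eq]
  have hz : PowerSeries.coeff r (D * ((PowerSeries.mk fun i =>
      PowerSeries.coeff (i + (r + 1)) c).subst s * s ^ (r + 1))) = 0 := by
    refine PowerSeries.X_pow_dvd_iff.mp (?_ : PowerSeries.X ^ (r + 1) ∣ _) r (Nat.lt_succ_self r)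
    refine Dvd.dvd.mul_left (Dvd.dvd.mul_left (pow_dvd_pow_of_dvd ?_ _) _) _
    exact ⟨PowerSeries.C t * D ^ 2, by rw [hs]; ring⟩
  rw [h3, mul_add, map_add, hz, zero_add, Finset.mul_sum, map_sum]
  refine Finset.sum_congr rfl fun m hm => ?_
  have hm' : m ≤ r := Nat.lt_succ_iff.mp (Finset.mem_range.mp hm)
  have h4 : D * (PowerSeries.C (catalan m : R) * s ^ m) =
      PowerSeries.C ((catalan m : R) * t ^ m) *
        (PowerSeries.X ^ m * D ^ (2 * m + 1)) := by
    rw [hs, map_mul, map_pow]; ring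
  obtain ⟨q, rfl⟩ := Nat.exists_eq_add_of_le hm'
  rw [h4, PowerSeries.coeff_C_mul, add_comm m q, PowerSeries.coeff_X_pow_mul,
    coeff_mk_pow_pow_succ, Nat.add_sub_cancel, show q + m + m = 2 * m + q by ring]
  ring

/-- This is `c = 1 + X c²` at `X = s`: writing `F` for the transform, `c(s) = (1 - z X) F` and `s
c(s)² = t X F²`. -/
theorem catalanTransform_functional_eq {R : Type*} [CommRing R] (z t : R) :
    catalanTransform z t = 1 + PowerSeries.C z * PowerSeries.X * catalanTransform z t +
      PowerSeries.C t * PowerSeries.X * catalanTransform z t ^ 2 := by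
  set D : PowerSeries R := PowerSeries.mk (fun n => z ^ n) with hD
  set s : PowerSeries R := PowerSeries.C t * PowerSeries.X * D ^ 2 with hs
  set c := PowerSeries.map (Nat.castRingHom R) PowerSeries.catalanSeries with hc
  have hsub : PowerSeries.HasSubst s :=
    PowerSeries.HasSubst.of_constantCoeff_zero' (by simp [hs])
  have hcat : c ^ 2 * PowerSeries.X + 1 = c := by
    have := congrArg (PowerSeries.map (Nat.castRingHom R))
      PowerSeries.catalanSeries_sq_mul_X_add_one
    simpa using this
  have h1 : (c.subst s) ^ 2 * s + 1 = c.subst s := by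
    have h := congrArg (fun f => PowerSeries.substAlgHom (R := R) hsub f) hcat
    simp only [map_add, map_mul, map_pow, map_one, PowerSeries.substAlgHom_X] at h
    simpa only [PowerSeries.coe_substAlgHom] using h
  have hDinv := mk_pow_mul_one_sub z
  rw [← hD] at hDinv
  have h2 : c.subst s = (1 - PowerSeries.C z * PowerSeries.X) * catalanTransform z t := by
    rw [catalanTransform, ← mul_assoc, mul_comm _ (PowerSeries.mk _), ← hD, hDinv, one_mul]
  have h3 : (c.subst s) ^ 2 * s =
      PowerSeries.C t * PowerSeries.X * catalanTransform z t ^ 2 := by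
    rw [catalanTransform, ← hD, ← hs, hs]; ring
  rw [h3, h2] at h1
  linear_combination -h1

theorem genCatalan_eq_coeff (r : ℕ) :
    genCatalan r = PowerSeries.coeff r (catalanTransform z (1 - z)) := by
  rw [coeff_catalanTransform, genCatalan_eq_sum_catalan]

theorem genCatalan_zero : genCatalan 0 = 1 := by
  simp [genCatalan]

theorem genCatalan_succ (r : ℕ) :
    genCatalan (r + 1) = z * genCatalan r +
      (1 - z) * ∑ p ∈ Finset.HasAntidiagonal.antidiagonal r, genCatalan p.1 * genCatalan p.2 := by
  have h := congrArg (PowerSeries.coeff (r + 1))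
    (catalanTransform_functional_eq z (1 - z))
  rw [map_add, map_add, mul_assoc, mul_assoc, PowerSeries.coeff_C_mul, PowerSeries.coeff_C_mul,
    PowerSeries.coeff_succ_X_mul, PowerSeries.coeff_succ_X_mul, sq, PowerSeries.coeff_mul] at h
  simpa [← genCatalan_eq_coeff, PowerSeries.coeff_one] using h

/-- The contribution of a cycle of length `l` to the top coefficients. -/
def cycleWeight (l : ℕ) : ℂ[X] := if l ≤ 1 then 1 else (1 - z) * genCatalan (l - 1)

theorem cycleWeight_one : cycleWeight 1 = 1 := by simp [cycleWeight]

theorem cycleWeight_add_two (r : ℕ) :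
    cycleWeight (r + 2) = (1 - z) * genCatalan (r + 1) := by simp [cycleWeight]

/-- Since `cycleWeight 1` is `1` and not `1 - z`, the two end terms of the convolution carry one
factor `1 - z` fewer; this turns the `+ z` of `genCatalan_succ` into `- z`. At `r = 0` the two ends
coincide. -/
theorem cycleWeight_recursion (r : ℕ) :
    cycleWeight (r + 2) = ∑ p ∈ Finset.HasAntidiagonal.antidiagonal r, cycleWeight (p.1 + 1) * cycleWeight (p.2 + 1)
      - z * cycleWeight (r + 1) := by
  rcases r with _ | r
  · rw [cycleWeight_add_two, genCatalan_succ]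
    simp [cycleWeight_one, genCatalan_zero]
  · rw [cycleWeight_add_two, genCatalan_succ, Finset.Nat.antidiagonal_succ,
      Finset.sum_cons, Finset.sum_map]
    rcases r with _ | r
    · simp [cycleWeight_one, cycleWeight_add_two 0, genCatalan_zero, genCatalan_succ]
      ring
    · rw [Finset.sum_cons, Finset.sum_map, Finset.Nat.antidiagonal_succ', Finset.sum_cons,
        Finset.sum_map, Finset.sum_cons, Finset.sum_map]
      simp only [Function.Embedding.prodMap, Function.Embedding.coeFn_mk, Prod.map,
        Nat.succ_eq_add_one, Function.Embedding.refl_apply, zero_add, cycleWeight_one,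
        add_assoc, Nat.reduceAdd, cycleWeight_add_two, genCatalan_zero]
      have : ∑ x ∈ Finset.HasAntidiagonal.antidiagonal r, (1 - z) * genCatalan (x.1 + 1) *
          ((1 - z) * genCatalan (x.2 + 1)) =
          (1 - z) ^ 2 * ∑ x ∈ Finset.HasAntidiagonal.antidiagonal r, genCatalan (x.1 + 1) * genCatalan (x.2 + 1) := by
        rw [Finset.mul_sum]
        exact Finset.sum_congr rfl fun _ _ => by ring
      rw [this]
      ring

end GenCatalan

/-! ### Cutting and joining cycles by a transposition. -/

section Cycles

variable {α : Type*} [Fintype α] [DecidableEq α]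

/-- The least number of transpositions whose product is `σ`. -/
def reflLength (σ : Equiv.Perm α) : ℕ := (σ.cycleType.map (fun l => l - 1)).sum

/-- The product of the cycle weights of `σ`. -/
def permWeight (σ : Equiv.Perm α) : ℂ[X] := (σ.cycleType.map cycleWeight).prod

theorem reflLength_one : reflLength (1 : Equiv.Perm α) = 0 := by simp [reflLength]

theorem permWeight_one : permWeight (1 : Equiv.Perm α) = 1 := by simp [permWeight]

theorem eq_one_of_reflLength_eq_zero {σ : Equiv.Perm α} (h : reflLength σ = 0) : σ = 1 := by
  rw [reflLength, Multiset.sum_eq_zero_iff] at h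
  rw [← Equiv.Perm.cycleType_eq_zero, Multiset.eq_zero_iff_forall_notMem]
  intro l hl
  have h1 := Equiv.Perm.two_le_of_mem_cycleType hl
  have h2 := h _ (Multiset.mem_map_of_mem _ hl)
  omega

theorem reflLength_conj (σ τ : Equiv.Perm α) : reflLength (τ * σ * τ⁻¹) = reflLength σ := by
  rw [reflLength, Equiv.Perm.cycleType_conj, reflLength]

theorem reflLength_mul_of_disjoint {σ τ : Equiv.Perm α} (h : σ.Disjoint τ) :
    reflLength (σ * τ) = reflLength σ + reflLength τ := by
  simp [reflLength, h.cycleType_mul]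

theorem permWeight_mul_of_disjoint {σ τ : Equiv.Perm α} (h : σ.Disjoint τ) :
    permWeight (σ * τ) = permWeight σ * permWeight τ := by
  simp [permWeight, h.cycleType_mul]

/-- The two products are conjugate. Jucys-Murphy elements act on the right, whereas cutting and
joining are described on the left. -/
theorem cycleType_mul_swap (σ : Equiv.Perm α) (a b : α) :
    (σ * Equiv.swap a b).cycleType = (Equiv.swap a b * σ).cycleType := by
  have := Equiv.Perm.cycleType_conj (σ := σ * Equiv.swap a b) (τ := Equiv.swap a b)
  rw [← this, Equiv.swap_inv, mul_assoc, mul_assoc, Equiv.swap_mul_self, mul_one]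

theorem reflLength_mul_swap (σ : Equiv.Perm α) (a b : α) :
    reflLength (σ * Equiv.swap a b) = reflLength (Equiv.swap a b * σ) := by
  rw [reflLength, cycleType_mul_swap, reflLength]

theorem permWeight_mul_swap (σ : Equiv.Perm α) (a b : α) :
    permWeight (σ * Equiv.swap a b) = permWeight (Equiv.swap a b * σ) := by
  rw [permWeight, cycleType_mul_swap, permWeight]

theorem formPerm_eq_one_of_length_le_one {α : Type*} [DecidableEq α] {l : List α} (hl : l.length ≤ 1) : l.formPerm = 1 := by
  match l, hl with
  | [], _ => simp
  | [_], _ => simp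

theorem cycleType_formPerm_of_nodup {l : List α} (hl : l.Nodup) (h : 2 ≤ l.length) :
    l.formPerm.cycleType = {l.length} := by
  rw [(List.isCycle_formPerm hl h).cycleType, List.support_formPerm_of_nodup l hl,
    List.toFinset_card_of_nodup hl]
  rintro x rfl
  simp at h

theorem reflLength_formPerm {l : List α} (hl : l.Nodup) :
    reflLength l.formPerm = l.length - 1 := by
  rcases Nat.lt_or_ge l.length 2 with h | h
  · rw [formPerm_eq_one_of_length_le_one (by omega), reflLength_one]; omega
  · rw [reflLength, cycleType_formPerm_of_nodup hl h]; simp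

theorem permWeight_formPerm {l : List α} (hl : l.Nodup) :
    permWeight l.formPerm = cycleWeight l.length := by
  rcases Nat.lt_or_ge l.length 2 with h | h
  · rw [formPerm_eq_one_of_length_le_one (by omega), permWeight_one, cycleWeight,
      if_pos (by omega)]
  · rw [permWeight, cycleType_formPerm_of_nodup hl h]; simp

theorem formPerm_append_singleton {α : Type*} [DecidableEq α] {a b : α} {l : List α} (h : (a :: l ++ [b]).Nodup) :
    (a :: l ++ [b]).formPerm = Equiv.swap a b * (a :: l).formPerm := by
  induction l generalizing a with
  | nil => simp
  | cons x l ih =>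
    have hn : (x :: l ++ [b]).Nodup := (List.nodup_cons.mp h).2
    simp only [List.cons_append] at ih hn h ⊢
    rw [List.formPerm_cons_cons, ih hn, List.formPerm_cons_cons, ← mul_assoc, ← mul_assoc]
    congr 1
    simp only [List.nodup_cons, List.mem_cons, List.mem_append, not_or] at h
    have hab : a ≠ b := h.1.2.2.1
    have hxb : x ≠ b := h.2.1.2.1
    rw [Equiv.mul_swap_eq_swap_mul, Equiv.swap_apply_right,
      Equiv.swap_apply_of_ne_of_ne (Ne.symm hab) (Ne.symm hxb)]

theorem formPerm_append_cons {α : Type*} [DecidableEq α] (a b : α) (l₁ l₂ : List α) :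
    (a :: l₁ ++ b :: l₂).formPerm = (a :: l₁ ++ [b]).formPerm * (b :: l₂).formPerm := by
  induction l₁ generalizing a with
  | nil => simp
  | cons x l ih =>
    simp only [List.cons_append] at ih ⊢
    rw [List.formPerm_cons_cons, ih, List.formPerm_cons_cons, mul_assoc]

/-- Read in one direction this joins two cycles, in the other it cuts one. -/
theorem formPerm_append {α : Type*} [DecidableEq α] {a b : α} {l₁ l₂ : List α} (h : (a :: l₁ ++ b :: l₂).Nodup) :
    (a :: l₁ ++ b :: l₂).formPerm =
      Equiv.swap a b * ((a :: l₁).formPerm * (b :: l₂).formPerm) := by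
  rw [formPerm_append_cons, formPerm_append_singleton, mul_assoc]
  refine h.sublist ?_
  exact (List.Sublist.refl _).append (by simp)

theorem disjoint_formPerm {α : Type*} [DecidableEq α] {l : List α} {ρ : Equiv.Perm α} (h : ∀ y ∈ l, ρ y = y) :
    l.formPerm.Disjoint ρ := fun y => by
  by_cases hy : y ∈ l
  · exact Or.inr (h y hy)
  · exact Or.inl (List.formPerm_apply_of_notMem hy)

/-- The cycle through `x` is written as a list starting at `x`. A fixed point gives the list `[x]`,
so it needs no separate treatment later. -/
theorem exists_cycle_decomposition (σ : Equiv.Perm α) (x : α) :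
    ∃ (l : List α) (ρ : Equiv.Perm α), (x :: l).Nodup ∧ σ = (x :: l).formPerm * ρ ∧
      (∀ y ∈ x :: l, ρ y = y) ∧ ∀ y, y ∈ x :: l ↔ σ.SameCycle x y := by
  by_cases hx : x ∈ σ.support
  · have hpos := Equiv.Perm.length_toList_pos_of_mem_support σ x hx
    obtain ⟨a, l, hl⟩ := List.exists_cons_of_length_pos hpos
    have ha : a = x := by
      have := Equiv.Perm.toList_getElem_zero σ x hx
      simpa [hl] using this
    subst ha
    have hnd := Equiv.Perm.nodup_toList σ a
    have hform := Equiv.Perm.formPerm_toList σ a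
    have hmem : ∀ y, y ∈ σ.toList a ↔ σ.SameCycle a y := fun y => by
      rw [Equiv.Perm.mem_toList_iff]; exact and_iff_left hx
    rw [hl] at hnd hform hmem
    refine ⟨l, (σ.cycleOf a)⁻¹ * σ, hnd, by rw [hform, mul_inv_cancel_left], fun y hy => ?_, hmem⟩
    rw [Equiv.Perm.mul_apply, Equiv.Perm.inv_eq_iff_eq, Equiv.Perm.SameCycle.cycleOf_apply]
    exact (hmem y).mp hy
  · have hfix : σ x = x := by simpa using hx
    refine ⟨[], σ, by simp, by simp, by simpa using hfix, fun y => ?_⟩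
    rw [List.mem_singleton]
    constructor
    · rintro rfl; exact Equiv.Perm.SameCycle.refl _ _
    · intro h; exact (h.eq_of_left hfix).symm

theorem reflLength_swap_mul_of_sameCycle {σ : Equiv.Perm α} {a b : α} (hab : a ≠ b)
    (h : σ.SameCycle a b) : reflLength (Equiv.swap a b * σ) + 1 = reflLength σ := by
  obtain ⟨l, ρ, hnd, hσ, hρ, hmem⟩ := exists_cycle_decomposition σ a
  have hb : b ∈ l := by simpa [hab.symm] using (hmem b).mpr h
  obtain ⟨l₁, l₂, rfl⟩ := List.append_of_mem hb
  rw [← List.cons_append] at *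
  have h1 : (a :: l₁).Nodup := hnd.sublist (List.sublist_append_left _ _)
  have h2 : (b :: l₂).Nodup := hnd.sublist (List.sublist_append_right _ _)
  have hρ1 : ∀ y ∈ a :: l₁, ((b :: l₂).formPerm * ρ) y = y := fun y hy => by
    rw [Equiv.Perm.mul_apply, hρ y (List.mem_append_left _ hy)]
    exact List.formPerm_apply_of_notMem (List.disjoint_of_nodup_append hnd hy)
  have h3 : Equiv.swap a b * σ = (a :: l₁).formPerm * ((b :: l₂).formPerm * ρ) := by
    rw [hσ, formPerm_append hnd, mul_assoc, Equiv.swap_mul_self_mul, mul_assoc]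
  rw [h3, reflLength_mul_of_disjoint (disjoint_formPerm hρ1),
    reflLength_mul_of_disjoint (disjoint_formPerm fun y hy => hρ y (List.mem_append_right _ hy)),
    hσ, reflLength_mul_of_disjoint (disjoint_formPerm hρ), reflLength_formPerm hnd,
    reflLength_formPerm h1, reflLength_formPerm h2]
  simp
  omega

theorem reflLength_swap_mul_of_not_sameCycle {σ : Equiv.Perm α} {a b : α}
    (h : ¬ σ.SameCycle a b) : reflLength (Equiv.swap a b * σ) = reflLength σ + 1 := by
  obtain ⟨l₁, ρ, h1, hσ, hρ, hmem⟩ := exists_cycle_decomposition σ a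
  obtain ⟨l₂, τ, h2, hρτ, hτ, hmem2⟩ := exists_cycle_decomposition ρ b
  have hb : b ∉ a :: l₁ := fun hb => h ((hmem b).mp hb)
  -- A common point is fixed by `ρ` and lies in the `ρ`-cycle of `b`, so it equals `b`.
  have hdisj : ∀ y ∈ a :: l₁, y ∉ b :: l₂ := fun y hy hy2 => by
    have := ((hmem2 y).mp hy2).symm.eq_of_left (hρ y hy)
    exact hb (this ▸ hy)
  have hnd : (a :: l₁ ++ b :: l₂).Nodup := h1.append h2 hdisj
  have hτ1 : ∀ y ∈ a :: l₁, τ y = y := fun y hy => by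
    have h3 := hρ y hy
    rw [hρτ, Equiv.Perm.mul_apply] at h3
    by_contra hne
    have h4 : (b :: l₂).formPerm y = y := List.formPerm_apply_of_notMem (hdisj y hy)
    exact hne ((b :: l₂).formPerm.injective (h3.trans h4.symm))
  have h3 : Equiv.swap a b * σ = (a :: l₁ ++ b :: l₂).formPerm * τ := by
    rw [formPerm_append hnd, hσ, hρτ]; simp only [mul_assoc]
  have hτ' : ∀ y ∈ a :: l₁ ++ b :: l₂, τ y = y := fun y hy =>
    (List.mem_append.mp hy).elim (hτ1 y) (hτ y)
  rw [h3, reflLength_mul_of_disjoint (disjoint_formPerm hτ'), hσ,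
    reflLength_mul_of_disjoint (disjoint_formPerm hρ), hρτ,
    reflLength_mul_of_disjoint (disjoint_formPerm hτ), reflLength_formPerm hnd,
    reflLength_formPerm h1, reflLength_formPerm h2]
  simp
  omega

theorem reflLength_le_swap_mul (σ : Equiv.Perm α) {a b : α} (hab : a ≠ b) :
    reflLength σ ≤ reflLength (Equiv.swap a b * σ) + 1 := by
  by_cases h : σ.SameCycle a b
  · exact (reflLength_swap_mul_of_sameCycle hab h).ge
  · have := reflLength_swap_mul_of_not_sameCycle h
    omega

/-- Cutting a cycle of length `r + 2` at the other points gives the lengths `(i + 1, r - i + 1)`, `0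
≤ i ≤ r`, so this is `cycleWeight_recursion` times the weight of the remaining cycles. The
subtracted term is `i = r`: the last entry `σ⁻¹ x` splits off as a fixed point. -/
theorem permWeight_eq_sum_swap_mul {σ : Equiv.Perm α} {x : α} (hx : σ x ≠ x) (s : Finset α)
    (hs : ∀ i, i ∈ s ↔ i ≠ x ∧ σ.SameCycle x i) :
    permWeight σ = ∑ i ∈ s, permWeight (Equiv.swap x i * σ) -
      z * permWeight (Equiv.swap x (σ⁻¹ x) * σ) := by
  obtain ⟨l, ρ, hnd, hσ, hρ, hmem⟩ := exists_cycle_decomposition σ x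
  have hxl : x ∉ l := (List.nodup_cons.mp hnd).1
  have hnl : l.Nodup := (List.nodup_cons.mp hnd).2
  have hl : l ≠ [] := by
    rintro rfl
    apply hx
    rw [hσ]; simpa using hρ x (by simp)
  obtain ⟨r, hr⟩ : ∃ r, l.length = r + 1 :=
    Nat.exists_eq_succ_of_ne_zero (by simpa using hl)
  have hsplit : ∀ (i : ℕ) (hi : i < l.length), permWeight (Equiv.swap x l[i] * σ) =
      cycleWeight (i + 1) * cycleWeight (r - i + 1) * permWeight ρ := by
    intro i hi
    have hdrop : l = l.take i ++ l[i] :: l.drop (i + 1) := by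
      rw [List.cons_getElem_drop_succ, List.take_append_drop]
    set b := l[i] with hb
    set l₁ := l.take i with hl₁
    set l₂ := l.drop (i + 1) with hl₂
    have hcons : x :: l = x :: l₁ ++ b :: l₂ := by rw [List.cons_append, ← hdrop]
    have hlen1 : (x :: l₁).length = i + 1 := by simp [hl₁]; omega
    have hlen2 : (b :: l₂).length = r - i + 1 := by simp [hl₂]; omega
    rw [hcons] at hnd hσ hρ
    have h1 : (x :: l₁).Nodup := hnd.sublist (List.sublist_append_left _ _)
    have h2 : (b :: l₂).Nodup := hnd.sublist (List.sublist_append_right _ _)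
    have hρ1 : ∀ y ∈ x :: l₁, ((b :: l₂).formPerm * ρ) y = y := fun y hy => by
      rw [Equiv.Perm.mul_apply, hρ y (List.mem_append_left _ hy)]
      exact List.formPerm_apply_of_notMem (List.disjoint_of_nodup_append hnd hy)
    have h3 : Equiv.swap x b * σ = (x :: l₁).formPerm * ((b :: l₂).formPerm * ρ) := by
      rw [hσ, formPerm_append hnd, mul_assoc, Equiv.swap_mul_self_mul, mul_assoc]
    rw [h3, permWeight_mul_of_disjoint (disjoint_formPerm hρ1),
      permWeight_mul_of_disjoint (disjoint_formPerm fun y hy => hρ y (List.mem_append_right _ hy)),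
      permWeight_formPerm h1, permWeight_formPerm h2, hlen1, hlen2, mul_assoc]
  have hlast : σ⁻¹ x = l[r] := by
    rw [Equiv.Perm.inv_eq_iff_eq, hσ, Equiv.Perm.mul_apply, hρ _ (by simp)]
    have := List.formPerm_apply_getElem_length x l
    simpa [hr] using this.symm
  have hsl : s = l.toFinset := by
    ext i
    rw [hs, ← hmem, List.mem_toFinset, List.mem_cons]
    constructor
    · rintro ⟨h1, h2 | h2⟩
      · exact absurd h2 h1
      · exact h2
    · intro h
      exact ⟨fun hi => hxl (hi ▸ h), Or.inr h⟩
  have hsum : ∑ i ∈ s, permWeight (Equiv.swap x i * σ) =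
      ∑ i ∈ Finset.range (r + 1),
        cycleWeight (i + 1) * cycleWeight (r - i + 1) * permWeight ρ := by
    rw [hsl, List.sum_toFinset _ hnl, ← hr, Finset.sum_range, ← Fin.sum_univ_fun_getElem]
    exact Finset.sum_congr rfl fun i _ => hsplit i i.2
  rw [hsum, hlast, hsplit r (by omega), Nat.sub_self, zero_add, cycleWeight_one, mul_one, hσ,
    permWeight_mul_of_disjoint (disjoint_formPerm hρ), permWeight_formPerm hnd, List.length_cons,
    hr, cycleWeight_recursion,
    Finset.Nat.sum_antidiagonal_eq_sum_range_succ_mk, sub_mul, Finset.sum_mul, mul_assoc]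

end Cycles

/-! ### Products of the series `(1 - q a X) / (1 - a X)`. -/

section Series

/-- The power series `(1 - q a X) / (1 - a X)`. -/
def ratioSeries {R A : Type*} [CommRing R] [Ring A] [Algebra R A] (q : R) (a : A) :
    PowerSeries A :=
  PowerSeries.mk fun j => if j = 0 then 1 else (1 - q) • a ^ j

variable {R A : Type*} [CommRing R] [Ring A] [Algebra R A]

theorem ratioSeries_mul_one_sub (q : R) (a : A) :
    ratioSeries q a * (1 - PowerSeries.C a * PowerSeries.X) =
      1 - PowerSeries.C (q • a) * PowerSeries.X := by
  ext n
  rw [mul_sub, mul_one, map_sub, map_sub, ← mul_assoc]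
  rcases n with _ | _ | n
  · simp [ratioSeries]
  · simp [ratioSeries, PowerSeries.coeff_succ_mul_X, PowerSeries.coeff_one, sub_smul]
  · simp [ratioSeries, PowerSeries.coeff_succ_mul_X, PowerSeries.coeff_one, pow_succ]

theorem sum_antidiagonalTuple_succ {M : Type*} [AddCommMonoid M] (n k : ℕ)
    (f : (Fin (n + 1) → ℕ) → M) :
    ∑ a ∈ Finset.Nat.antidiagonalTuple (n + 1) k, f a =
      ∑ p ∈ Finset.HasAntidiagonal.antidiagonal k,
        ∑ b ∈ Finset.Nat.antidiagonalTuple n p.2, f (Fin.cons p.1 b) := by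
  rw [Finset.sum_sigma']
  refine Finset.sum_nbij' (fun a => ⟨(a 0, ∑ i, Fin.tail a i), Fin.tail a⟩)
    (fun s => Fin.cons s.1.1 s.2) ?_ ?_ ?_ ?_ ?_
  · intro a ha
    rw [Finset.Nat.mem_antidiagonalTuple, Fin.sum_univ_succ] at ha
    simp only [Finset.mem_sigma, Finset.HasAntidiagonal.mem_antidiagonal,
      Finset.Nat.mem_antidiagonalTuple]
    exact ⟨ha, trivial⟩
  · rintro ⟨p, b⟩ h
    simp only [Finset.mem_sigma, Finset.HasAntidiagonal.mem_antidiagonal,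
      Finset.Nat.mem_antidiagonalTuple] at h
    rw [Finset.Nat.mem_antidiagonalTuple, Fin.sum_univ_succ]
    simp [h.1, h.2]
  · intro a _
    exact Fin.cons_self_tail a
  · rintro ⟨⟨p1, p2⟩, b⟩ h
    simp only [Finset.mem_sigma, Finset.HasAntidiagonal.mem_antidiagonal,
      Finset.Nat.mem_antidiagonalTuple] at h
    obtain ⟨-, rfl⟩ := h
    simp
  · intro a _
    rw [Fin.cons_self_tail]

theorem coeff_prod_ofFn {A : Type*} [Semiring A] {n : ℕ} (F : Fin n → PowerSeries A) (k : ℕ) :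
    PowerSeries.coeff k (List.ofFn F).prod = ∑ a ∈ Finset.Nat.antidiagonalTuple n k,
      (List.ofFn fun i => PowerSeries.coeff (a i) (F i)).prod := by
  induction n generalizing k with
  | zero =>
    rcases k with _ | k
    · simp
    · simp [PowerSeries.coeff_one]
  | succ n ih =>
    rw [List.ofFn_succ, List.prod_cons, PowerSeries.coeff_mul, sum_antidiagonalTuple_succ]
    refine Finset.sum_congr rfl fun p _ => ?_
    rw [ih, Finset.mul_sum]
    refine Finset.sum_congr rfl fun b _ => ?_
    rw [List.ofFn_succ, List.prod_cons]
    simp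

/-- Ordered products over a possibly noncommutative `A` let one expansion serve both the variables
and the Jucys-Murphy elements. -/
theorem coeff_prod_ratioSeries {n : ℕ} (q : R) (y : Fin n → A) (k : ℕ) :
    PowerSeries.coeff k (List.ofFn fun i => ratioSeries q (y i)).prod =
      ∑ a ∈ Finset.Nat.antidiagonalTuple n k,
        (1 - q) ^ (Finset.univ.filter fun i => a i ≠ 0).card •
          (List.ofFn fun i => y i ^ a i).prod := by
  rw [coeff_prod_ofFn]
  refine Finset.sum_congr rfl fun a _ => ?_
  have key : ∀ (n : ℕ) (a : Fin n → ℕ) (y : Fin n → A),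
      (List.ofFn fun i => PowerSeries.coeff (a i) (ratioSeries q (y i))).prod =
      (∏ i, if a i ≠ 0 then (1 - q) else 1) • (List.ofFn fun i => y i ^ a i).prod := by
    intro n
    induction n with
    | zero => simp
    | succ n ih =>
      intro a y
      rw [List.ofFn_succ, List.prod_cons, ih (fun i => a i.succ) (fun i => y i.succ),
        List.ofFn_succ, List.prod_cons, Fin.prod_univ_succ]
      rw [mul_smul_comm, mul_comm, mul_smul, ratioSeries, PowerSeries.coeff_mk]
      by_cases h : a 0 = 0
      · simp [h]
      · simp [h]
  rw [key, Finset.prod_ite]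
  simp

end Series

/-! ### Jucys-Murphy elements and their generating products. -/

section GroupAlgebra

variable {n : ℕ}

/-- The product of the first `m` members of a finite sequence. -/
def partialProd {M : Type*} [Monoid M] (F : Fin n → M) (m : ℕ) : M := ((List.ofFn F).take m).prod

theorem partialProd_zero {M : Type*} [Monoid M] (F : Fin n → M) : partialProd F 0 = 1 := by
  simp [partialProd]

theorem partialProd_succ {M : Type*} [Monoid M] (F : Fin n → M) (m : ℕ) (h : m < n) :
    partialProd F (m + 1) = partialProd F m * F ⟨m, h⟩ := by
  rw [partialProd, List.prod_take_succ _ _ (by simpa using h), partialProd]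
  simp

theorem partialProd_self {M : Type*} [Monoid M] (F : Fin n → M) :
    partialProd F n = (List.ofFn F).prod := by
  rw [partialProd, List.take_of_length_le (by simp)]

theorem coeff_mul_of (A : GroupAlg n) (π σ : Equiv.Perm (Fin n)) :
    (A * MonoidAlgebra.of ℂ[X] _ π).coeff σ = A.coeff (σ * π⁻¹) := by
  rw [MonoidAlgebra.of_apply, MonoidAlgebra.coeff_mul_single_eq_coeff_mul (σ * π⁻¹), mul_one]
  intro τ _
  exact eq_mul_inv_iff_mul_eq.symm

theorem coeff_of_mul (A : GroupAlg n) (π σ : Equiv.Perm (Fin n)) :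
    (MonoidAlgebra.of ℂ[X] _ π * A).coeff σ = A.coeff (π⁻¹ * σ) := by
  rw [MonoidAlgebra.of_apply, MonoidAlgebra.coeff_single_mul_eq_mul_coeff (π⁻¹ * σ), one_mul]
  intro τ _
  exact eq_inv_mul_iff_mul_eq.symm

theorem coeff_mul_jucysMurphy (A : GroupAlg n) (i : Fin n) (σ : Equiv.Perm (Fin n)) :
    (A * jucysMurphy n i).coeff σ =
      ∑ j ∈ Finset.univ.filter (fun j => j < i), A.coeff (σ * Equiv.swap i j) := by
  rw [jucysMurphy, Finset.mul_sum, MonoidAlgebra.coeff_sum, Finset.sum_apply']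
  refine Finset.sum_congr rfl fun j _ => ?_
  rw [coeff_mul_of, Equiv.swap_inv, Equiv.swap_comm]

/-- Such a `π` fixes `i` and permutes the `j < i`, so conjugation by it permutes the summands of
`J_i`. -/
theorem commute_of_jucysMurphy (i : Fin n) (π : Equiv.Perm (Fin n)) (hπ : ∀ j, i ≤ j → π j = j) :
    Commute (MonoidAlgebra.of ℂ[X] _ π) (jucysMurphy n i) := by
  have hlt : ∀ j, j < i ↔ π j < i := fun j => by
    constructor
    · intro h
      by_contra hj
      have := hπ _ (not_lt.mp hj)
      exact hj ((π.injective this).symm ▸ h)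
    · intro h
      by_contra hj
      rw [hπ _ (not_lt.mp hj)] at h
      exact hj h
  rw [Commute, SemiconjBy, jucysMurphy, Finset.mul_sum, Finset.sum_mul]
  refine Finset.sum_bij (fun j _ => π j) (fun j hj => ?_) (fun _ _ _ _ h => π.injective h)
    (fun j hj => ⟨π.symm j, ?_, by simp⟩) (fun j _ => ?_)
  · exact Finset.mem_filter.mpr ⟨Finset.mem_univ _, (hlt j).mp (Finset.mem_filter.mp hj).2⟩
  · exact Finset.mem_filter.mpr ⟨Finset.mem_univ _,
      (hlt _).mpr (by rw [Equiv.apply_symm_apply]; exact (Finset.mem_filter.mp hj).2)⟩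
  · rw [← map_mul, ← map_mul, Equiv.mul_swap_eq_swap_mul, hπ i le_rfl]

theorem commute_jucysMurphy (i j : Fin n) : Commute (jucysMurphy n i) (jucysMurphy n j) := by
  wlog h : i < j generalizing i j
  · rcases (not_lt.mp h).lt_or_eq with h | rfl
    · exact (this _ _ h).symm
    · exact Commute.refl _
  conv_lhs => rw [jucysMurphy]
  refine Commute.sum_left _ _ _ fun l hl => commute_of_jucysMurphy _ _ fun m hm => ?_
  have hl' : l < i := by simpa using hl
  exact Equiv.swap_apply_of_ne_of_ne ((hl'.trans h).trans_le hm).ne' (h.trans_le hm).ne'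

/-- The product of the factors `(1 - q J_i X) / (1 - J_i X)` with `i < m`. -/
def ratioProd (n m : ℕ) (q : ℂ[X]) : PowerSeries (GroupAlg n) :=
  partialProd (fun i => ratioSeries q (jucysMurphy n i)) m

/-- The product of the factors `1 - q J_i X` with `i < m`. -/
def linearProd (n m : ℕ) (q : ℂ[X]) : PowerSeries (GroupAlg n) :=
  partialProd (fun i => 1 - PowerSeries.C (q • jucysMurphy n i) * PowerSeries.X) m

theorem ratioProd_succ_mul (m : ℕ) (h : m < n) (q : ℂ[X]) :
    ratioProd n (m + 1) q * (1 - PowerSeries.C (jucysMurphy n ⟨m, h⟩) * PowerSeries.X) =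
      ratioProd n m q * (1 - PowerSeries.C (q • jucysMurphy n ⟨m, h⟩) * PowerSeries.X) := by
  rw [ratioProd, partialProd_succ _ _ h, mul_assoc, ratioSeries_mul_one_sub, ratioProd]

theorem coeff_zero_ratioProd (m : ℕ) (hm : m ≤ n) (q : ℂ[X]) :
    PowerSeries.coeff 0 (ratioProd n m q) = 1 := by
  induction m with
  | zero => simp [ratioProd, partialProd_zero]
  | succ m ih =>
    rw [ratioProd, partialProd_succ _ _ hm, PowerSeries.coeff_mul, ← ratioProd]
    simp only [Finset.HasAntidiagonal.antidiagonal_zero, Finset.sum_singleton, ih (by omega)]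
    simp [ratioSeries]

theorem coeff_succ_mul_one_sub {A : Type*} [Ring A] (F : PowerSeries A) (a : A) (k : ℕ) :
    PowerSeries.coeff (k + 1) (F * (1 - PowerSeries.C a * PowerSeries.X)) =
      PowerSeries.coeff (k + 1) F - PowerSeries.coeff k F * a := by
  rw [mul_sub, mul_one, map_sub, ← mul_assoc, PowerSeries.coeff_succ_mul_X,
    PowerSeries.coeff_mul_C]

/-- Comparing coefficients after clearing one denominator; the support, length and top-coefficient
lemmas below are inductions along this recursion. -/
theorem coeff_succ_ratioProd (m k : ℕ) (h : m < n) (q : ℂ[X]) :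
    PowerSeries.coeff (k + 1) (ratioProd n (m + 1) q) =
      PowerSeries.coeff (k + 1) (ratioProd n m q) +
      PowerSeries.coeff k (ratioProd n (m + 1) q) * jucysMurphy n ⟨m, h⟩ -
      q • (PowerSeries.coeff k (ratioProd n m q) * jucysMurphy n ⟨m, h⟩) := by
  have := congrArg (PowerSeries.coeff (k + 1)) (ratioProd_succ_mul m h q)
  rw [coeff_succ_mul_one_sub, coeff_succ_mul_one_sub, mul_smul_comm] at this
  rw [sub_eq_iff_eq_add] at this
  rw [this]; abel

theorem coeff_succ_linearProd (m k : ℕ) (h : m < n) (q : ℂ[X]) :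
    PowerSeries.coeff (k + 1) (linearProd n (m + 1) q) =
      PowerSeries.coeff (k + 1) (linearProd n m q) -
      q • (PowerSeries.coeff k (linearProd n m q) * jucysMurphy n ⟨m, h⟩) := by
  rw [linearProd, partialProd_succ _ _ h, coeff_succ_mul_one_sub, mul_smul_comm, linearProd]

theorem coeff_zero_linearProd (m : ℕ) (hm : m ≤ n) (q : ℂ[X]) :
    PowerSeries.coeff 0 (linearProd n m q) = 1 := by
  induction m with
  | zero => simp [linearProd, partialProd_zero]
  | succ m ih =>
    rw [linearProd, partialProd_succ _ _ hm, PowerSeries.coeff_mul, ← linearProd]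
    simp only [Finset.HasAntidiagonal.antidiagonal_zero, Finset.sum_singleton, ih (by omega)]
    simp

theorem commute_one_sub {A : Type*} [Ring A] {a b : A} (h : Commute a b) :
    Commute (1 - PowerSeries.C a * PowerSeries.X : PowerSeries A)
      (1 - PowerSeries.C b * PowerSeries.X) := by
  have hX : ∀ F : PowerSeries A, Commute F PowerSeries.X := PowerSeries.commute_X
  have h1 : Commute (PowerSeries.C a * PowerSeries.X : PowerSeries A)
      (PowerSeries.C b * PowerSeries.X) :=
    ((h.map PowerSeries.C).mul_right (hX _)).mul_left ((hX _).symm)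
  exact (Commute.one_left _).sub_left ((Commute.one_right _).sub_right h1)

theorem commute_linearProd (m : ℕ) (hm : m ≤ n) (p q : ℂ[X]) (i : Fin n) :
    Commute (1 - PowerSeries.C (p • jucysMurphy n i) * PowerSeries.X) (linearProd n m q) := by
  induction m with
  | zero => rw [linearProd, partialProd_zero]; exact Commute.one_right _
  | succ m ih =>
    rw [linearProd, partialProd_succ _ _ hm, ← linearProd]
    exact (ih (by omega)).mul_right
      (commute_one_sub (((commute_jucysMurphy i _).smul_left p).smul_right q))

theorem ratioProd_mul_linearProd (m : ℕ) (hm : m ≤ n) (q : ℂ[X]) :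
    ratioProd n m q * linearProd n m 1 = linearProd n m q := by
  induction m with
  | zero => simp [ratioProd, linearProd, partialProd_zero]
  | succ m ih =>
    have h1 := commute_linearProd m (by omega) 1 1 ⟨m, hm⟩
    have h2 := commute_linearProd m (by omega) q 1 ⟨m, hm⟩
    rw [show linearProd n (m + 1) 1 = linearProd n m 1 * _ from partialProd_succ _ _ hm, ← h1.eq,
      ← mul_assoc, one_smul, ratioProd_succ_mul, mul_assoc, h2.eq, ← mul_assoc, ih (by omega)]
    exact (partialProd_succ _ _ hm).symm

end GroupAlgebra

/-! ### Coefficients at a single permutation. -/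

section Coefficients

variable {n : ℕ}

/-- Uniqueness in the factorization `σ = τ (m j)` with `τ` fixing everything from `m` on: `j` must
be `σ⁻¹ m`. -/
theorem fixes_mul_swap_iff {m : ℕ} (h : m < n) (σ : Equiv.Perm (Fin n)) {j : Fin n}
    (hj : j < ⟨m, h⟩) : (∀ i : Fin n, m ≤ i → (σ * Equiv.swap ⟨m, h⟩ j) i = i) ↔
      (∀ i : Fin n, m + 1 ≤ i → σ i = i) ∧ σ j = ⟨m, h⟩ := by
  have hne : ∀ i : Fin n, m + 1 ≤ i → i ≠ ⟨m, h⟩ ∧ i ≠ j := fun i hi => by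
    rw [Fin.lt_def] at hj
    simp only at hj
    refine ⟨fun h' => ?_, fun h' => ?_⟩ <;> subst h'
    · simp at hi
    · omega
  constructor
  · intro H
    refine ⟨fun i hi => ?_, ?_⟩
    · have := H i (by omega)
      rwa [Equiv.Perm.mul_apply, Equiv.swap_apply_of_ne_of_ne (hne i hi).1 (hne i hi).2] at this
    · have := H ⟨m, h⟩ le_rfl
      rwa [Equiv.Perm.mul_apply, Equiv.swap_apply_left] at this
  · rintro ⟨H1, H2⟩ i hi
    rcases eq_or_lt_of_le hi with hi | hi
    · have : i = ⟨m, h⟩ := Fin.ext hi.symm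
      rw [this, Equiv.Perm.mul_apply, Equiv.swap_apply_left, H2]
    · rw [Equiv.Perm.mul_apply, Equiv.swap_apply_of_ne_of_ne (hne i hi).1 (hne i hi).2, H1 i hi]

theorem fixes_succ_of_fixes {m : ℕ} {σ : Equiv.Perm (Fin n)}
    (h : ∀ i : Fin n, m + 1 ≤ i → (σ i = i)) (hm : m < n) (hσ : σ ⟨m, hm⟩ = ⟨m, hm⟩) :
    ∀ i : Fin n, m ≤ i → σ i = i := fun i hi => by
  rcases eq_or_lt_of_le hi with hi | hi
  · rwa [show i = ⟨m, hm⟩ from Fin.ext hi.symm]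
  · exact h i hi

theorem fixes_of_fixes_mul_swap {m : ℕ} (h : m < n) {σ : Equiv.Perm (Fin n)} {j : Fin n}
    (hj : j < ⟨m, h⟩) (H : ∀ i : Fin n, m + 1 ≤ i → (σ * Equiv.swap ⟨m, h⟩ j) i = i) :
    ∀ i : Fin n, m + 1 ≤ i → σ i = i := fun i hi => by
  rw [Fin.lt_def] at hj
  simp only at hj
  have := H i hi
  rwa [Equiv.Perm.mul_apply, Equiv.swap_apply_of_ne_of_ne] at this
  · rintro rfl; simp at hi
  · rintro rfl; omega

theorem lt_of_sameCycle {m : ℕ} (h : m < n) {σ : Equiv.Perm (Fin n)}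
    (hσ : ∀ i : Fin n, m + 1 ≤ i → σ i = i) {j : Fin n} (hj : j ≠ ⟨m, h⟩)
    (hs : σ.SameCycle ⟨m, h⟩ j) : j < ⟨m, h⟩ := by
  by_contra hlt
  rw [Fin.lt_def, not_lt] at hlt
  simp only at hlt
  have h1 : m ≠ (j : ℕ) := fun h' => hj (Fin.ext h'.symm)
  exact hj (hs.symm.eq_of_left (hσ j (by omega)))

theorem sameCycle_of_apply_eq {σ : Equiv.Perm (Fin n)} {a b : Fin n} (h : σ b = a) :
    σ.SameCycle a b := by
  rw [← h]; exact (Equiv.Perm.SameCycle.refl σ b).apply_left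

theorem coeff_one_apply (σ : Equiv.Perm (Fin n)) :
    (1 : GroupAlg n).coeff σ = if σ = 1 then 1 else 0 := by
  rw [MonoidAlgebra.one_def, MonoidAlgebra.coeff_single, Finsupp.single_apply]
  simp only [eq_comm]

/-- Jucys' factorization: expanding the product reaches each permutation of the first `m` points
exactly once, and every transposition used adds one to `reflLength` and one factor `-q`. -/
theorem coeff_linearProd (m : ℕ) (hm : m ≤ n) (q : ℂ[X]) (k : ℕ) (σ : Equiv.Perm (Fin n)) :
    (PowerSeries.coeff k (linearProd n m q)).coeff σ =
      if (∀ i : Fin n, m ≤ i → σ i = i) ∧ reflLength σ = k then (-q) ^ k else 0 := by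
  classical
  induction m generalizing k σ with
  | zero =>
    have hσ : (∀ i : Fin n, 0 ≤ (i : ℕ) → σ i = i) ↔ σ = 1 := by
      simp [Equiv.ext_iff]
    rw [linearProd, partialProd_zero, PowerSeries.coeff_one]
    by_cases h1 : σ = 1
    · subst h1
      rcases k with _ | k
      · simp [reflLength_one]
      · simp [reflLength_one]
    · rw [if_neg (c := _ ∧ _) fun h => h1 (hσ.mp h.1)]
      split_ifs
      · rw [coeff_one_apply, if_neg h1]
      · simp
  | succ m ih =>
    rcases k with _ | k
    · rw [coeff_zero_linearProd _ hm, pow_zero, coeff_one_apply]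
      refine if_congr ?_ rfl rfl
      constructor
      · rintro rfl; simp [reflLength_one]
      · intro h; exact eq_one_of_reflLength_eq_zero h.2
    · rw [coeff_succ_linearProd _ _ hm, MonoidAlgebra.coeff_sub, Finsupp.sub_apply,
        MonoidAlgebra.coeff_smul_apply, coeff_mul_jucysMurphy, ih (by omega)]
      by_cases hσ : σ ⟨m, hm⟩ = ⟨m, hm⟩
      · have hz : ∀ j ∈ Finset.univ.filter (fun j : Fin n => j < ⟨m, hm⟩),
            (PowerSeries.coeff k (linearProd n m q)).coeff (σ * Equiv.swap ⟨m, hm⟩ j) = 0 := by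
          intro j hj
          have hj' := (Finset.mem_filter.mp hj).2
          rw [ih (by omega), if_neg]
          rintro ⟨h1, -⟩
          rw [fixes_mul_swap_iff hm σ hj'] at h1
          exact hj'.ne (σ.injective (h1.2.trans hσ.symm))
        rw [Finset.sum_eq_zero hz, smul_zero, sub_zero]
        refine if_congr ?_ rfl rfl
        refine and_congr_left fun _ => ⟨fun h i hi => h i (by omega), fun h =>
          fixes_succ_of_fixes h hm hσ⟩
      · rw [if_neg (fun h => hσ (h.1 _ le_rfl)), zero_sub]
        by_cases hfix : ∀ i : Fin n, m + 1 ≤ i → σ i = i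
        · set b := σ⁻¹ ⟨m, hm⟩ with hb
          have hσb : σ b = ⟨m, hm⟩ := σ.apply_symm_apply _
          have hbne : b ≠ ⟨m, hm⟩ := fun h => hσ (by rw [← h] at hσb ⊢; rw [hσb])
          have hsame : σ.SameCycle ⟨m, hm⟩ b := sameCycle_of_apply_eq hσb
          have hblt : b < ⟨m, hm⟩ := lt_of_sameCycle hm hfix hbne hsame
          rw [Finset.sum_eq_single b]
          · rw [ih (by omega), reflLength_mul_swap]
            have h1 := reflLength_swap_mul_of_sameCycle hbne.symm hsame
            have h2 := (fixes_mul_swap_iff hm σ hblt).mpr ⟨hfix, hσb⟩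
            have h3 : (reflLength (Equiv.swap ⟨m, hm⟩ b * σ) = k) ↔ reflLength σ = k + 1 := by
              omega
            by_cases h4 : reflLength σ = k + 1
            · rw [if_pos ⟨h2, h3.mpr h4⟩, if_pos ⟨hfix, h4⟩, smul_eq_mul, pow_succ]; ring
            · rw [if_neg fun h => h4 (h3.mp h.2), if_neg fun h => h4 h.2, smul_zero, neg_zero]
          · intro j hj hjb
            rw [ih (by omega), if_neg]
            rintro ⟨h1, -⟩
            rw [fixes_mul_swap_iff hm σ (Finset.mem_filter.mp hj).2] at h1
            exact hjb (σ.injective (h1.2.trans hσb.symm))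
          · intro h
            exact (h (Finset.mem_filter.mpr ⟨Finset.mem_univ _, hblt⟩)).elim
        · rw [if_neg (fun h => hfix h.1), Finset.sum_eq_zero, smul_zero, neg_zero]
          intro j hj
          rw [ih (by omega), if_neg]
          rintro ⟨h1, -⟩
          rw [fixes_mul_swap_iff hm σ (Finset.mem_filter.mp hj).2] at h1
          exact hfix h1.1

theorem commute_of_coeff_linearProd (q : ℂ[X]) (k : ℕ) (π : Equiv.Perm (Fin n)) :
    Commute (MonoidAlgebra.of ℂ[X] _ π) (PowerSeries.coeff k (linearProd n n q)) := by
  have hcyc : ∀ σ : Equiv.Perm (Fin n), reflLength (π⁻¹ * σ) = reflLength (σ * π⁻¹) := fun σ => by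
    rw [← reflLength_conj (σ * π⁻¹) π⁻¹]
    congr 1
    group
  refine MonoidAlgebra.ext (Finsupp.ext fun σ => ?_)
  rw [coeff_mul_of, coeff_of_mul, coeff_linearProd _ le_rfl, coeff_linearProd _ le_rfl, hcyc]
  refine if_congr ?_ rfl rfl
  refine and_congr_left fun _ => ⟨fun _ i hi => ?_, fun _ i hi => ?_⟩ <;> omega

/-- As `linearProd n n 1` has constant term `1`, `ratioProd_mul_linearProd` can be solved degree by
degree for the coefficients of `ratioProd`, so centrality passes to them. -/
theorem commute_of_coeff_ratioProd (q : ℂ[X]) (k : ℕ) (π : Equiv.Perm (Fin n)) :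
    Commute (MonoidAlgebra.of ℂ[X] _ π) (PowerSeries.coeff k (ratioProd n n q)) := by
  induction k using Nat.strong_induction_on with
  | _ k ih =>
    rcases k with _ | k
    · rw [coeff_zero_ratioProd _ le_rfl]; exact Commute.one_right _
    · have h := congrArg (PowerSeries.coeff (k + 1)) (ratioProd_mul_linearProd n le_rfl q)
      rw [PowerSeries.coeff_mul, Finset.Nat.antidiagonal_succ', Finset.sum_cons,
        coeff_zero_linearProd _ le_rfl, mul_one] at h
      rw [eq_sub_of_add_eq h, Finset.sum_map]
      refine (commute_of_coeff_linearProd _ _ _).sub_right (Commute.sum_right _ _ _ fun p hp => ?_)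
      have := Finset.HasAntidiagonal.mem_antidiagonal.mp hp
      exact (ih p.1 (by omega)).mul_right (commute_of_coeff_linearProd _ _ _)

theorem coeff_ratioProd_conj (q : ℂ[X]) (k : ℕ) (π σ : Equiv.Perm (Fin n)) :
    (PowerSeries.coeff k (ratioProd n n q)).coeff (π * σ * π⁻¹) =
      (PowerSeries.coeff k (ratioProd n n q)).coeff σ := by
  have h := congrArg (fun A : GroupAlg n => A.coeff (π * σ)) (commute_of_coeff_ratioProd q k π).eq
  beta_reduce at h
  rw [coeff_mul_of, coeff_of_mul, inv_mul_cancel_left] at h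
  exact h.symm

theorem coeff_ratioProd_of_not_fixes (m : ℕ) (hm : m ≤ n) (q : ℂ[X]) (k : ℕ)
    (σ : Equiv.Perm (Fin n)) (hσ : ¬ ∀ i : Fin n, m ≤ i → σ i = i) :
    (PowerSeries.coeff k (ratioProd n m q)).coeff σ = 0 := by
  induction m generalizing k σ with
  | zero =>
    have h1 : σ ≠ 1 := by rintro rfl; simp at hσ
    rw [ratioProd, partialProd_zero, PowerSeries.coeff_one]
    split_ifs
    · rw [coeff_one_apply, if_neg h1]
    · simp
  | succ m ih =>
    induction k generalizing σ with
    | zero =>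
      have h1 : σ ≠ 1 := by rintro rfl; simp at hσ
      rw [coeff_zero_ratioProd _ hm, coeff_one_apply, if_neg h1]
    | succ k ihk =>
      rw [coeff_succ_ratioProd _ _ hm, MonoidAlgebra.coeff_sub, Finsupp.sub_apply,
        MonoidAlgebra.coeff_add, Finsupp.add_apply, MonoidAlgebra.coeff_smul_apply,
        coeff_mul_jucysMurphy, coeff_mul_jucysMurphy,
        ih (by omega) _ _ fun h => hσ fun i hi => h i (by omega),
        Finset.sum_eq_zero fun j hj => ?_, Finset.sum_eq_zero fun j hj => ?_]
      · simp
      · refine ih (by omega) _ _ fun h => hσ ?_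
        exact ((fixes_mul_swap_iff hm σ (Finset.mem_filter.mp hj).2).mp h).1
      · exact ihk _ fun h => hσ (fixes_of_fixes_mul_swap hm (Finset.mem_filter.mp hj).2 h)

/-- Each power of `X` brings one transposition, which raises `reflLength` by at most one. -/
theorem coeff_ratioProd_of_lt_reflLength (m : ℕ) (hm : m ≤ n) (q : ℂ[X]) (k : ℕ)
    (σ : Equiv.Perm (Fin n)) (hσ : k < reflLength σ) :
    (PowerSeries.coeff k (ratioProd n m q)).coeff σ = 0 := by
  have hne : ∀ σ : Equiv.Perm (Fin n), ∀ k, k < reflLength σ → σ ≠ 1 := by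
    rintro σ k h rfl; simp [reflLength_one] at h
  induction m generalizing k σ with
  | zero =>
    rw [ratioProd, partialProd_zero, PowerSeries.coeff_one]
    split_ifs
    · rw [coeff_one_apply, if_neg (hne σ k hσ)]
    · simp
  | succ m ih =>
    induction k generalizing σ with
    | zero =>
      rw [coeff_zero_ratioProd _ hm, coeff_one_apply, if_neg (hne σ 0 hσ)]
    | succ k ihk =>
      have hlt : ∀ j ∈ Finset.univ.filter (fun j : Fin n => j < ⟨m, hm⟩),
          k < reflLength (σ * Equiv.swap ⟨m, hm⟩ j) := fun j hj => by
        have := reflLength_le_swap_mul σ (Finset.mem_filter.mp hj).2.ne'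
        rw [reflLength_mul_swap]
        omega
      rw [coeff_succ_ratioProd _ _ hm, MonoidAlgebra.coeff_sub, Finsupp.sub_apply,
        MonoidAlgebra.coeff_add, Finsupp.add_apply, MonoidAlgebra.coeff_smul_apply,
        coeff_mul_jucysMurphy, coeff_mul_jucysMurphy, ih (by omega) _ _ hσ,
        Finset.sum_eq_zero fun j hj => ihk _ (hlt j hj),
        Finset.sum_eq_zero fun j hj => ih (by omega) _ _ (hlt j hj)]
      simp

/-- If `σ` fixes `m`, every swap joins cycles and the length bound kills both sums of the recursion.
Otherwise the term from `m` factors vanishes, the first sum keeps only the `j` in the cycle of `m`,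
and the second only `j = σ⁻¹ m`; what is left is `permWeight_eq_sum_swap_mul`. -/
theorem coeff_reflLength_ratioProd (m : ℕ) (hm : m ≤ n) (k : ℕ) (σ : Equiv.Perm (Fin n))
    (hσ : ∀ i : Fin n, m ≤ i → σ i = i) (hk : reflLength σ = k) :
    (PowerSeries.coeff k (ratioProd n m z)).coeff σ = permWeight σ := by
  induction m generalizing k σ with
  | zero =>
    obtain rfl : σ = 1 := Equiv.ext fun i => hσ i (by omega)
    obtain rfl : k = 0 := by rw [← hk, reflLength_one]
    simp [ratioProd, partialProd_zero, permWeight_one, MonoidAlgebra.one_def]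
  | succ m ih =>
    induction k generalizing σ with
    | zero =>
      obtain rfl := eq_one_of_reflLength_eq_zero hk
      rw [coeff_zero_ratioProd _ hm, permWeight_one, MonoidAlgebra.one_def]
      simp
    | succ k ihk =>
      rw [coeff_succ_ratioProd _ _ hm, MonoidAlgebra.coeff_sub, Finsupp.sub_apply,
        MonoidAlgebra.coeff_add, Finsupp.add_apply, MonoidAlgebra.coeff_smul_apply,
        coeff_mul_jucysMurphy, coeff_mul_jucysMurphy]
      by_cases hfix : σ ⟨m, hm⟩ = ⟨m, hm⟩
      · have hlt : ∀ j ∈ Finset.univ.filter (fun j : Fin n => j < ⟨m, hm⟩),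
            k < reflLength (σ * Equiv.swap ⟨m, hm⟩ j) := fun j hj => by
          have hns : ¬ σ.SameCycle ⟨m, hm⟩ j := fun h =>
            (Finset.mem_filter.mp hj).2.ne (h.eq_of_left hfix).symm
          rw [reflLength_mul_swap, reflLength_swap_mul_of_not_sameCycle hns]
          omega
        rw [Finset.sum_eq_zero fun j hj => coeff_ratioProd_of_lt_reflLength _ hm _ _ _ (hlt j hj),
          Finset.sum_eq_zero fun j hj =>
            coeff_ratioProd_of_lt_reflLength m (by omega) _ _ _ (hlt j hj),
          ih (by omega) _ _ (fixes_succ_of_fixes hσ hm hfix) hk]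
        simp
      · rw [coeff_ratioProd_of_not_fixes m (by omega) _ _ _ (fun h => hfix (h _ le_rfl)), zero_add]
        set b := σ⁻¹ ⟨m, hm⟩ with hb
        have hσb : σ b = ⟨m, hm⟩ := σ.apply_symm_apply _
        have hbne : b ≠ ⟨m, hm⟩ := fun h => hfix (by rw [← h] at hσb ⊢; rw [hσb])
        have hsame : σ.SameCycle ⟨m, hm⟩ b := sameCycle_of_apply_eq hσb
        have hblt : b < ⟨m, hm⟩ := lt_of_sameCycle hm hσ hbne hsame
        classical
        set s := (Finset.univ.filter (fun j : Fin n => j < ⟨m, hm⟩)).filter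
          (fun j => σ.SameCycle ⟨m, hm⟩ j) with hs
        have hmem : ∀ j, j ∈ s ↔ j ≠ ⟨m, hm⟩ ∧ σ.SameCycle ⟨m, hm⟩ j := fun j => by
          simp only [hs, Finset.mem_filter, Finset.mem_univ, true_and]
          exact ⟨fun h => ⟨h.1.ne, h.2⟩, fun h => ⟨lt_of_sameCycle hm hσ h.1 h.2, h.2⟩⟩
        have hmove : ∀ j < (⟨m, hm⟩ : Fin n), ∀ i : Fin n, m + 1 ≤ i →
            (σ * Equiv.swap ⟨m, hm⟩ j) i = i := fun j hj i hi => by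
          rw [Fin.lt_def] at hj
          simp only at hj
          rw [Equiv.Perm.mul_apply, Equiv.swap_apply_of_ne_of_ne, hσ i hi]
          · rintro rfl; simp at hi
          · rintro rfl; omega
        have h1 : ∑ j ∈ Finset.univ.filter (fun j : Fin n => j < ⟨m, hm⟩),
            (PowerSeries.coeff k (ratioProd n (m + 1) z)).coeff (σ * Equiv.swap ⟨m, hm⟩ j) =
            ∑ j ∈ s, permWeight (Equiv.swap ⟨m, hm⟩ j * σ) := by
          rw [hs, Finset.sum_filter (fun j => σ.SameCycle ⟨m, hm⟩ j)]
          refine Finset.sum_congr rfl fun j hj => ?_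
          have hj' := (Finset.mem_filter.mp hj).2
          split_ifs with hsc
          · have := reflLength_swap_mul_of_sameCycle hj'.ne' hsc
            rw [ihk _ (hmove j hj') (by rw [reflLength_mul_swap]; omega), permWeight_mul_swap]
          · refine coeff_ratioProd_of_lt_reflLength _ hm _ _ _ ?_
            rw [reflLength_mul_swap, reflLength_swap_mul_of_not_sameCycle hsc]
            omega
        have h2 : ∑ j ∈ Finset.univ.filter (fun j : Fin n => j < ⟨m, hm⟩),
            (PowerSeries.coeff k (ratioProd n m z)).coeff (σ * Equiv.swap ⟨m, hm⟩ j) =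
            permWeight (Equiv.swap ⟨m, hm⟩ b * σ) := by
          rw [Finset.sum_eq_single b]
          · have := reflLength_swap_mul_of_sameCycle hbne.symm hsame
            rw [ih (by omega) _ _ ((fixes_mul_swap_iff hm σ hblt).mpr ⟨hσ, hσb⟩)
              (by rw [reflLength_mul_swap]; omega), permWeight_mul_swap]
          · intro j hj hjb
            refine coeff_ratioProd_of_not_fixes m (by omega) _ _ _ fun h => ?_
            rw [fixes_mul_swap_iff hm σ (Finset.mem_filter.mp hj).2] at h
            exact hjb (σ.injective (h.2.trans hσb.symm))
          · intro h
            exact (h (Finset.mem_filter.mpr ⟨Finset.mem_univ _, hblt⟩)).elim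
        rw [h1, h2, permWeight_eq_sum_swap_mul hfix s hmem, smul_eq_mul]

end Coefficients

/-! ### Partial fractions of the generating function. -/

section PartialFractions

variable {K : Type*} [Field K] {n : ℕ}

/-- The residue coefficients of the partial fraction expansion of `∏ (1 - q yᵢ X) / (1 - yᵢ X)`. -/
def residue (q : K) (y : Fin n → K) (i : Fin n) : K :=
  (1 - q) * y i * ∏ j ∈ Finset.univ.erase i, (y i - q * y j) / (y i - y j)

/-- Both sides have degree at most `n` and agree at the `n + 1` points `0` and `1 / y i`. -/
theorem prod_one_sub_mul_eq (q : K) (y : Fin n → K) (hy : Function.Injective y)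
    (hy0 : ∀ i, y i ≠ 0) :
    ∏ i, (1 - C (q * y i) * X) = ∏ i, (1 - C (y i) * X) +
      ∑ i, C (residue q y i) * X * ∏ j ∈ Finset.univ.erase i, (1 - C (y j) * X) := by
  classical
  have hdeg : ∀ (s : Finset (Fin n)) (c : Fin n → K),
      (∏ i ∈ s, (1 - C (c i) * X)).natDegree ≤ s.card := fun s c => by
    refine (natDegree_prod_le _ _).trans ?_
    rw [Finset.card_eq_sum_ones]
    refine Finset.sum_le_sum fun i _ => ?_
    compute_degree
  have hcard : (insert 0 (Finset.univ.image fun i => (y i)⁻¹)).card = n + 1 := by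
    rw [Finset.card_insert_of_notMem, Finset.card_image_of_injective, Finset.card_fin]
    · exact fun i j h => hy (inv_injective h)
    · simp [hy0]
  have hlt : ∀ f : K[X], f.natDegree ≤ n →
      f.degree < ((insert 0 (Finset.univ.image fun i => (y i)⁻¹)).card : WithBot ℕ) := fun f hf => by
    rw [hcard]
    exact degree_le_natDegree.trans_lt (by exact_mod_cast Nat.lt_succ_of_le hf)
  refine eq_of_degrees_lt_of_eval_finset_eq (insert 0 (Finset.univ.image fun i => (y i)⁻¹))
    (hlt _ ?_) (hlt _ ?_) ?_
  · simpa using hdeg Finset.univ fun i => q * y i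
  · refine natDegree_add_le_of_degree_le (by simpa using hdeg Finset.univ y) ?_
    refine natDegree_sum_le_of_forall_le _ _ fun i _ => ?_
    refine (natDegree_mul_le).trans ?_
    have h1 := hdeg (Finset.univ.erase i) y
    rw [Finset.card_erase_of_mem (Finset.mem_univ i), Finset.card_fin] at h1
    have h2 : (C (residue q y i) * X : K[X]).natDegree ≤ 1 := by compute_degree
    have := i.pos
    omega
  · intro u hu
    rcases Finset.mem_insert.mp hu with rfl | hu
    · simp [eval_prod, eval_finsetSum]
    · obtain ⟨l, -, rfl⟩ := Finset.mem_image.mp hu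
      have hl := hy0 l
      simp only [eval_prod, eval_add, eval_finsetSum, eval_mul, eval_sub, eval_one, eval_C, eval_X]
      have hz : ∏ j, (1 - y j * (y l)⁻¹) = 0 :=
        Finset.prod_eq_zero (Finset.mem_univ l) (by rw [mul_inv_cancel₀ hl, sub_self])
      -- At `1 / y l` every summand but the `l`-th contains the vanishing factor.
      rw [hz, zero_add,
        Finset.sum_eq_single l]
      · rw [← Finset.mul_prod_erase _ _ (Finset.mem_univ l), residue,
          show (1 - q) * y l * (∏ j ∈ Finset.univ.erase l, (y l - q * y j) / (y l - y j)) * (y l)⁻¹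
            * ∏ j ∈ Finset.univ.erase l, (1 - y j * (y l)⁻¹) =
            ((1 - q) * (y l * (y l)⁻¹)) * ((∏ j ∈ Finset.univ.erase l,
              (y l - q * y j) / (y l - y j)) *
            ∏ j ∈ Finset.univ.erase l, (1 - y j * (y l)⁻¹)) by ring, ← Finset.prod_mul_distrib]
        congr 1
        · rw [mul_assoc, mul_inv_cancel₀ hl]; ring
        · refine Finset.prod_congr rfl fun j hj => ?_
          have : y l - y j ≠ 0 := sub_ne_zero.mpr fun h => (Finset.mem_erase.mp hj).1 (hy h).symm
          field_simp
      · intro i _ hil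
        rw [Finset.prod_eq_zero (Finset.mem_erase.mpr ⟨hil.symm, Finset.mem_univ l⟩)
          (by rw [mul_inv_cancel₀ hl, sub_self]), mul_zero]
      · simp

theorem coeff_succ_prod_ratioSeries (q : K) (y : Fin n → K) (hy : Function.Injective y)
    (hy0 : ∀ i, y i ≠ 0) (k : ℕ) :
    PowerSeries.coeff (k + 1) (List.ofFn fun i => ratioSeries q (y i)).prod =
      ∑ i, residue q y i * y i ^ k := by
  have hg : ∀ i, PowerSeries.mk (fun n => y i ^ n) *
      (1 - PowerSeries.C (y i) * PowerSeries.X) = 1 := fun i => mk_pow_mul_one_sub (y i)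
  have hne : ∏ i, (1 - PowerSeries.C (y i) * PowerSeries.X) ≠ 0 := by
    refine Finset.prod_ne_zero_iff.mpr fun i _ h => ?_
    have := hg i
    rw [h, mul_zero] at this
    exact zero_ne_one this
  have h1 := congrArg (Polynomial.coeToPowerSeries.ringHom (R := K))
    (prod_one_sub_mul_eq q y hy hy0)
  simp only [map_prod, map_sub, map_add, map_mul, map_one, map_sum,
    Polynomial.coeToPowerSeries.ringHom_apply, Polynomial.coe_C, Polynomial.coe_X] at h1
  have h2 : (List.ofFn fun i => ratioSeries q (y i)).prod =
      1 + ∑ i, PowerSeries.C (residue q y i) *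
        (PowerSeries.X * PowerSeries.mk (fun n => y i ^ n)) := by
    apply mul_right_cancel₀ hne
    rw [List.prod_ofFn, ← Finset.prod_mul_distrib, add_mul, one_mul, Finset.sum_mul]
    simp only [ratioSeries_mul_one_sub, smul_eq_mul, map_mul]
    rw [h1]
    congr 1
    refine Finset.sum_congr rfl fun i _ => ?_
    rw [← Finset.mul_prod_erase _ _ (Finset.mem_univ i)]
    linear_combination -(PowerSeries.C (residue q y i) * PowerSeries.X *
      ∏ j ∈ Finset.univ.erase i, (1 - PowerSeries.C (y j) * PowerSeries.X)) * hg i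
  rw [h2, map_add, map_sum, PowerSeries.coeff_one, if_neg (Nat.succ_ne_zero k), zero_add]
  refine Finset.sum_congr rfl fun i _ => ?_
  rw [PowerSeries.coeff_C_mul, PowerSeries.coeff_succ_X_mul, PowerSeries.coeff_mk]

end PartialFractions

/-! ### The one-row function as a polynomial. -/

section RowPolynomial

/-- The one-row Hall-Littlewood polynomial, as the sum of `(1 - z)^(#supp a - 1) x^a` over the
exponents `a` of weight `k`. -/
def rowPoly (n k : ℕ) : MvPolynomial (Fin n) ℂ[X] :=
  ∑ a ∈ Finset.Nat.antidiagonalTuple n k, MvPolynomial.monomial (Finsupp.equivFunOnFinite.symm a)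
    ((1 - z) ^ ((Finset.univ.filter fun i => a i ≠ 0).card - 1))

/-- Positive weight forces nonempty support, so the truncated `- 1` in the exponent is a true
subtraction. -/
theorem one_sub_z_pow_card {n k : ℕ} (hk : 1 ≤ k) {a : Fin n → ℕ}
    (ha : a ∈ Finset.Nat.antidiagonalTuple n k) :
    (1 - z) * (1 - z) ^ ((Finset.univ.filter fun i => a i ≠ 0).card - 1) =
      (1 - z) ^ (Finset.univ.filter fun i => a i ≠ 0).card := by
  rw [← pow_succ', Nat.sub_add_cancel]
  rw [Nat.one_le_iff_ne_zero, Finset.card_ne_zero]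
  by_contra h
  rw [Finset.not_nonempty_iff_eq_empty, Finset.filter_eq_empty_iff] at h
  rw [Finset.Nat.mem_antidiagonalTuple, Finset.sum_eq_zero fun i hi => by simpa using h hi] at ha
  omega

theorem one_sub_z_ne_zero : (1 - z : ℂ[X]) ≠ 0 := fun h => by
  have := congrArg (Polynomial.eval 0) h
  simp at this

theorem evalJM_sum_monomial {n : ℕ} {ι : Type*} (s : Finset ι) (φ : ι ↪ (Fin n →₀ ℕ))
    (c : ι → ℂ[X]) :
    evalJM (∑ a ∈ s, MvPolynomial.monomial (φ a) (c a)) =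
      ∑ a ∈ s, c a • (List.ofFn fun i => jucysMurphy n i ^ φ a i).prod := by
  classical
  have hcoeff : ∀ e, MvPolynomial.coeff e (∑ a ∈ s, MvPolynomial.monomial (φ a) (c a)) =
      ∑ a ∈ s, if φ a = e then c a else 0 := fun e => by
    rw [MvPolynomial.coeff_sum]
    exact Finset.sum_congr rfl fun a _ => MvPolynomial.coeff_monomial _ _ _
  rw [evalJM, Finset.sum_subset (s₂ := s.map φ), Finset.sum_map]
  · refine Finset.sum_congr rfl fun a ha => ?_
    rw [hcoeff, Finset.sum_eq_single a, if_pos rfl]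
    · intro b _ hb
      rw [if_neg fun h => hb (φ.injective h)]
    · exact fun h => absurd ha h
  · intro e he
    rw [MvPolynomial.mem_support_iff, hcoeff] at he
    obtain ⟨a, ha, h⟩ := Finset.exists_ne_zero_of_sum_ne_zero he
    rw [Finset.mem_map]
    exact ⟨a, ha, by by_contra h'; exact h (if_neg h')⟩
  · intro e _ he
    rw [MvPolynomial.notMem_support_iff.mp he, zero_smul]

/-- The factor `1 - z` is not invertible in `ℂ[X]`; it is kept here and cancelled later as a nonzero
element of a domain. -/
theorem one_sub_z_smul_evalJM_rowPoly (n : ℕ) {k : ℕ} (hk : 1 ≤ k) :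
    (1 - z) • evalJM (rowPoly n k) = PowerSeries.coeff k (ratioProd n n z) := by
  have h := evalJM_sum_monomial (Finset.Nat.antidiagonalTuple n k)
    (Finsupp.equivFunOnFinite (α := Fin n) (M := ℕ)).symm.toEmbedding
    (fun a => (1 - z) ^ ((Finset.univ.filter fun i => a i ≠ 0).card - 1))
  rw [ratioProd, partialProd_self, coeff_prod_ratioSeries, rowPoly]
  refine (congrArg _ h).trans ?_
  rw [Finset.smul_sum]
  refine Finset.sum_congr rfl fun a ha => ?_
  rw [smul_smul, one_sub_z_pow_card hk ha]
  rfl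

theorem x_injective (n : ℕ) : Function.Injective (x n) := fun _ _ h =>
  MvPolynomial.X_injective (IsFractionRing.injective _ _ h)

theorem x_ne_zero (n : ℕ) (i : Fin n) : x n i ≠ 0 := fun h =>
  MvPolynomial.X_ne_zero i (IsFractionRing.injective _ (RatFun n) (h.trans (map_zero _).symm))

theorem one_sub_zz (n : ℕ) : 1 - zz n =
    algebraMap (MvPolynomial (Fin n) ℂ[X]) (RatFun n) (MvPolynomial.C (1 - z)) := by
  rw [zz, map_sub, map_sub, map_one, map_one]

theorem one_sub_zz_ne_zero (n : ℕ) : 1 - zz n ≠ 0 := fun h => by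
  rw [one_sub_zz] at h
  have := IsFractionRing.injective (MvPolynomial (Fin n) ℂ[X]) (RatFun n)
    (h.trans (map_zero _).symm)
  rw [MvPolynomial.C_eq_zero] at this
  exact one_sub_z_ne_zero this

theorem one_sub_zz_mul_algebraMap_rowPoly (n : ℕ) {k : ℕ} (hk : 1 ≤ k) :
    (1 - zz n) * algebraMap (MvPolynomial (Fin n) ℂ[X]) (RatFun n) (rowPoly n k) =
      PowerSeries.coeff k (List.ofFn fun i => ratioSeries (zz n) (x n i)).prod := by
  rw [coeff_prod_ratioSeries, rowPoly, map_sum, Finset.mul_sum]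
  refine Finset.sum_congr rfl fun a ha => ?_
  rw [MvPolynomial.monomial_eq, one_sub_zz, ← map_mul, ← mul_assoc, ← map_mul,
    one_sub_z_pow_card hk ha, map_mul, map_pow, map_pow, smul_eq_mul, List.prod_ofFn,
    Finsupp.prod_fintype _ _ (fun i => pow_zero _), map_prod]
  simp only [map_pow]
  rfl

/-- Because `k ≥ 1`, the rearrangements of the row are the `n` distinct vectors `Pi.single i k`, and
only pairs starting at `i` give a factor. -/
theorem hallLittlewood_row (n : ℕ) (hn : 1 ≤ n) {k : ℕ} (hk : 1 ≤ k) :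
    hallLittlewood n (row n k) = ∑ i, x n i ^ k *
      ∏ j ∈ Finset.univ.erase i, (x n i - zz n * x n j) / (x n i - x n j) := by
  classical
  have himage : Finset.univ.image (fun w : Equiv.Perm (Fin n) => row n k ∘ w) =
      Finset.univ.image (fun i : Fin n => Pi.single i k) := by
    have hcomp : ∀ w : Equiv.Perm (Fin n), row n k ∘ w =
        Pi.single (w.symm ⟨0, hn⟩) k := fun w => by
      funext j
      rw [Function.comp_apply, row, Pi.single_apply]
      refine if_congr ?_ rfl rfl
      rw [Equiv.eq_symm_apply, Fin.ext_iff]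
    ext a
    simp only [Finset.mem_image, Finset.mem_univ, true_and, hcomp]
    constructor
    · rintro ⟨w, rfl⟩
      exact ⟨_, rfl⟩
    · rintro ⟨i, rfl⟩
      exact ⟨Equiv.swap ⟨0, hn⟩ i, by rw [Equiv.symm_swap, Equiv.swap_apply_left]⟩
  have hinj : Function.Injective (fun i : Fin n => (Pi.single i k : Fin n → ℕ)) := fun i _ h => by
    by_contra hij
    have := congrFun h i
    simp only [Pi.single_eq_same, Pi.single_eq_of_ne hij] at this
    omega
  rw [hallLittlewood, himage, Finset.sum_image hinj.injOn]
  refine Finset.sum_congr rfl fun i _ => ?_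
  congr 1
  · rw [Finset.prod_eq_single i]
    · rw [Pi.single_eq_same]
    · intro j _ hj
      rw [Pi.single_eq_of_ne hj, pow_zero]
    · simp
  · rw [Finset.prod_eq_single i]
    · rw [← Finset.mul_prod_erase _ _ (Finset.mem_univ i), if_neg (lt_irrefl _), one_mul]
      refine Finset.prod_congr rfl fun j hj => ?_
      rw [Pi.single_eq_same, Pi.single_eq_of_ne (Finset.mem_erase.mp hj).1, if_pos (by omega)]
    · intro j _ hj
      refine Finset.prod_eq_one fun l _ => ?_
      rw [Pi.single_eq_of_ne hj, if_neg (Nat.not_lt_zero _)]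
    · simp

theorem algebraMap_rowPoly (n : ℕ) (hn : 1 ≤ n) {k : ℕ} (hk : 1 ≤ k) :
    algebraMap (MvPolynomial (Fin n) ℂ[X]) (RatFun n) (rowPoly n k) =
      hallLittlewood n (row n k) := by
  apply mul_left_cancel₀ (one_sub_zz_ne_zero n)
  obtain ⟨k, rfl⟩ := Nat.exists_eq_add_of_le' hk
  rw [one_sub_zz_mul_algebraMap_rowPoly n hk, hallLittlewood_row n hn hk,
    coeff_succ_prod_ratioSeries _ _ (x_injective n) (x_ne_zero n), Finset.mul_sum]
  refine Finset.sum_congr rfl fun i _ => ?_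
  rw [residue]
  ring

end RowPolynomial

/-! ### Class expansion and its top coefficients. -/

section ClassExpansion

theorem coeff_classSum (n : ℕ) (μ : Multiset ℕ) (σ : Equiv.Perm (Fin n)) :
    (classSum n μ).coeff σ = if σ.partition.parts = μ then 1 else 0 := by
  classical
  rw [classSum, MonoidAlgebra.coeff_sum, Finset.sum_apply']
  simp only [MonoidAlgebra.of_apply, MonoidAlgebra.coeff_single, Finsupp.single_apply]
  rw [Finset.sum_ite_eq']
  simp

/-- The partition with the parts of `ν` and `j` further parts `1`. -/
def addOnes (ν : Multiset ℕ) (hν : ∀ l ∈ ν, 2 ≤ l) (j : ℕ) : (ν.sum + j).Partition where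
  parts := ν + Multiset.replicate j 1
  parts_pos := fun {i} hi => by
    rcases Multiset.mem_add.mp hi with h | h
    · exact (hν i h).trans_lt' (by norm_num)
    · rw [Multiset.eq_of_mem_replicate h]; exact one_pos
  parts_sum := by simp

theorem filter_ne_one_add_replicate (ν : Multiset ℕ) (j : ℕ) :
    (ν + Multiset.replicate j 1).filter (fun i => i ≠ 1) = ν.filter (fun i => i ≠ 1) := by
  rw [Multiset.filter_add, add_eq_left, Multiset.filter_eq_nil]
  intro l hl
  simpa using Multiset.eq_of_mem_replicate hl

theorem filter_ne_one_eq_self {ν : Multiset ℕ} (hν : ∀ l ∈ ν, 2 ≤ l) :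
    ν.filter (fun i => i ≠ 1) = ν :=
  Multiset.filter_eq_self.mpr fun l hl => by have := hν l hl; omega

theorem filter_addOnes (ν : Multiset ℕ) (hν : ∀ l ∈ ν, 2 ≤ l) (j : ℕ) :
    (addOnes ν hν j).parts.filter (fun i => i ≠ 1) = ν :=
  (filter_ne_one_add_replicate ν j).trans (filter_ne_one_eq_self hν)

theorem reducedWeight_addOnes (ν : Multiset ℕ) (hν : ∀ l ∈ ν, 2 ≤ l) (j : ℕ) :
    reducedWeight (addOnes ν hν j) = ν.sum := by
  rw [reducedWeight, filter_addOnes]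

theorem mult_one_addOnes (ν : Multiset ℕ) (hν : ∀ l ∈ ν, 2 ≤ l) (j : ℕ) :
    mult 1 (addOnes ν hν j) = j := by
  rw [mult, addOnes, Multiset.count_add, Multiset.count_replicate_self,
    Multiset.count_eq_zero_of_notMem fun h => by simpa using hν 1 h, zero_add]

/-- Only the partitions `ν ∪ 1^j` with `j ≤ N` pad to the type of `σ`, so the class expansion at `σ`
is a binomial expansion in the number `N` of fixed points. -/
theorem coeff_classExpansion (c : (m : ℕ) → m.Partition → ℂ[X]) (n : ℕ)
    (σ : Equiv.Perm (Fin n)) (ν : Multiset ℕ) (hν : ∀ l ∈ ν, 2 ≤ l) (N : ℕ)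
    (hσ : σ.cycleType = ν) (hN : n = ν.sum + N) :
    (∑ m ∈ Finset.range (n + 1), ∑ ρ : m.Partition,
      (c m ρ * ((n - reducedWeight ρ).choose (mult 1 ρ) : ℂ[X])) •
        classSum n (padOnes n ρ)).coeff σ =
      ∑ j ∈ Finset.range (N + 1), c (ν.sum + j) (addOnes ν hν j) * (N.choose j : ℂ[X]) := by
  classical
  have hparts : σ.partition.parts = ν + Multiset.replicate N 1 := by
    rw [Equiv.Perm.parts_partition, ← Equiv.Perm.sum_cycleType, hσ, Fintype.card_fin, hN,
      Nat.add_sub_cancel_left]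
  have hcoeff : ∀ (m : ℕ) (ρ : m.Partition),
      ((c m ρ * ((n - reducedWeight ρ).choose (mult 1 ρ) : ℂ[X])) •
        classSum n (padOnes n ρ)).coeff σ =
      if ν + Multiset.replicate N 1 = padOnes n ρ then
        c m ρ * ((n - reducedWeight ρ).choose (mult 1 ρ) : ℂ[X]) else 0 := fun m ρ => by
    rw [MonoidAlgebra.coeff_smul_apply, coeff_classSum, hparts, smul_eq_mul, mul_ite, mul_one,
      mul_zero]
  simp only [MonoidAlgebra.coeff_sum, Finset.sum_apply', hcoeff]
  rw [show n + 1 = ν.sum + (N + 1) by omega, Finset.sum_range_add, Finset.sum_eq_zero, zero_add]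
  · refine Finset.sum_congr rfl fun j hj => ?_
    have hj' : j ≤ N := Nat.lt_succ_iff.mp (Finset.mem_range.mp hj)
    have hrep : ν + Multiset.replicate N 1 =
        ν + Multiset.replicate j 1 + Multiset.replicate (n - (ν.sum + j)) 1 := by
      rw [add_assoc, ← Multiset.replicate_add]
      congr 2
      omega
    rw [Finset.sum_eq_single (addOnes ν hν j)]
    · rw [if_pos, reducedWeight_addOnes, mult_one_addOnes, hN, Nat.add_sub_cancel_left]
      exact hrep
    · intro ρ _ hρ
      rw [if_neg]
      intro h
      apply hρ
      rw [hrep, padOnes] at h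
      exact Nat.Partition.ext (add_right_cancel h).symm
    · simp
  · intro m hm
    refine Finset.sum_eq_zero fun ρ _ => if_neg fun h => ?_
    have h1 : ν = ρ.parts.filter (fun i => i ≠ 1) := by
      have h2 := congrArg (Multiset.filter (fun i => i ≠ 1)) h
      rwa [padOnes, filter_ne_one_add_replicate, filter_ne_one_add_replicate,
        filter_ne_one_eq_self hν] at h2
    obtain ⟨t, ht⟩ := Multiset.le_iff_exists_add.mp (Multiset.filter_le (fun i => i ≠ 1) ρ.parts)
    have h3 := congrArg Multiset.sum ht
    rw [← h1, ρ.parts_sum, Multiset.sum_add] at h3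
    have := Finset.mem_range.mp hm
    omega

theorem coeff_evalJM_rowPoly_eq {n k : ℕ} (hk : 1 ≤ k) {σ τ : Equiv.Perm (Fin n)}
    (h : σ.cycleType = τ.cycleType) :
    (evalJM (rowPoly n k)).coeff σ = (evalJM (rowPoly n k)).coeff τ := by
  obtain ⟨π, rfl⟩ := isConj_iff.mp (Equiv.Perm.isConj_iff_cycleType_eq.mpr h)
  apply mul_left_cancel₀ one_sub_z_ne_zero
  rw [← smul_eq_mul, ← smul_eq_mul, ← MonoidAlgebra.coeff_smul_apply,
    ← MonoidAlgebra.coeff_smul_apply, one_sub_z_smul_evalJM_rowPoly n hk, coeff_ratioProd_conj]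

open Classical in
/-- The coefficient, in `P_k(J_1, …, J_n)` with `n = ν.sum + N`, of a permutation of cycle type
`ν`. -/
def rowCoeff (k : ℕ) (ν : Multiset ℕ) (N : ℕ) : ℂ[X] :=
  if h : ∃ σ : Equiv.Perm (Fin (ν.sum + N)), σ.cycleType = ν then
    (evalJM (rowPoly (ν.sum + N) k)).coeff h.choose else 0

theorem rowCoeff_eq {k : ℕ} (hk : 1 ≤ k) (n : ℕ) (σ : Equiv.Perm (Fin n)) (ν : Multiset ℕ) (N : ℕ)
    (hσ : σ.cycleType = ν) (hN : n = ν.sum + N) :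
    rowCoeff k ν N = (evalJM (rowPoly n k)).coeff σ := by
  subst hN
  have h : ∃ σ : Equiv.Perm (Fin (ν.sum + N)), σ.cycleType = ν := ⟨σ, hσ⟩
  rw [rowCoeff, dif_pos h]
  exact coeff_evalJM_rowPoly_eq hk (h.choose_spec.trans hσ.symm)

/-- The coefficient for `ν ∪ 1^j` is the `j`-th forward difference at `0` of `N ↦ rowCoeff k ν N`;
Newton's formula recovers every value. -/
theorem exists_isClassExpansion {k : ℕ} (hk : 1 ≤ k) :
    ∃ c : (m : ℕ) → m.Partition → ℂ[X], IsClassExpansion k c := by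
  refine ⟨fun m ρ => (fwdDiff 1)^[mult 1 ρ] (rowCoeff k (ρ.parts.filter fun i => i ≠ 1)) 0,
    fun n hn => ⟨rowPoly n k, algebraMap_rowPoly n hn hk, ?_⟩⟩
  refine MonoidAlgebra.ext (Finsupp.ext fun σ => ?_)
  have hle : σ.cycleType.sum ≤ n := by simpa using σ.sum_cycleType_le
  obtain ⟨N, hN⟩ := Nat.exists_eq_add_of_le hle
  rw [coeff_classExpansion _ n σ σ.cycleType (fun l => Equiv.Perm.two_le_of_mem_cycleType) N rfl hN,
    ← rowCoeff_eq hk n σ _ N rfl hN]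
  have h := shift_eq_sum_fwdDiff_iter 1 (rowCoeff k σ.cycleType) N 0
  rw [zero_add, smul_eq_mul, mul_one] at h
  rw [h]
  refine Finset.sum_congr rfl fun j _ => ?_
  rw [mult_one_addOnes, filter_addOnes, nsmul_eq_mul, mul_comm]

theorem congr_of_parts_eq (c : (m : ℕ) → m.Partition → ℂ[X]) {m m' : ℕ} (ρ : m.Partition)
    (ρ' : m'.Partition) (h : ρ.parts = ρ'.parts) : c m ρ = c m' ρ' := by
  obtain rfl : m = m' := by rw [← ρ.parts_sum, h, ρ'.parts_sum]
  rw [Nat.Partition.ext h]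

theorem sum_map_sub_one_add_card (ν : Multiset ℕ) (hν : ∀ l ∈ ν, 1 ≤ l) :
    (ν.map fun l => l - 1).sum + Multiset.card ν = ν.sum := by
  induction ν using Multiset.induction_on with
  | empty => simp
  | cons a ν ih =>
    have h1 := hν a (Multiset.mem_cons_self _ _)
    have h2 := ih fun l hl => hν l (Multiset.mem_cons_of_mem hl)
    rw [Multiset.map_cons, Multiset.sum_cons, Multiset.card_cons, Multiset.sum_cons]
    omega

theorem prod_map_cycleWeight (ν : Multiset ℕ) (hν : ∀ l ∈ ν, 2 ≤ l) :
    (ν.map cycleWeight).prod =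
      (1 - z) ^ Multiset.card ν * (ν.map fun l => genCatalan (l - 1)).prod := by
  have h : ∀ l ∈ ν, cycleWeight l = (1 - z) * genCatalan (l - 1) := fun l hl =>
    if_neg (by have := hν l hl; omega)
  rw [Multiset.map_congr rfl h, Multiset.prod_map_mul, Multiset.map_const',
    Multiset.prod_replicate]

/-- At `n = |ρ|` there are no fixed points, so the binomial sum is the single term `c m ρ`, and
`reflLength σ = k` makes it a top coefficient. -/
theorem IsClassExpansion.eq_of_mult_one_eq_zero {k : ℕ} (hk : 1 ≤ k)
    {c : (m : ℕ) → m.Partition → ℂ[X]} (hc : IsClassExpansion k c) {m : ℕ} (ρ : m.Partition)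
    (hρ : m = len ρ + k) (h1 : mult 1 ρ = 0) :
    c m ρ = (1 - z) ^ (len ρ - 1) * (ρ.parts.map fun r => genCatalan (r - 1)).prod := by
  obtain ⟨P, hP, hexp⟩ := hc m (by omega)
  obtain rfl : P = rowPoly m k := IsFractionRing.injective _ (RatFun m)
    (hP.trans (algebraMap_rowPoly m (by omega) hk).symm)
  have hparts : ∀ l ∈ ρ.parts, 2 ≤ l := fun l hl => by
    have h2 := ρ.parts_pos hl
    have h3 : l ≠ 1 := by
      rintro rfl
      exact Multiset.count_eq_zero.mp h1 hl
    omega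
  obtain ⟨σ, hσ⟩ := (Equiv.Perm.exists_with_cycleType_iff (α := Fin m) (m := ρ.parts)).mpr
    ⟨by simp [ρ.parts_sum], hparts⟩
  have hcoeff := congrArg (fun A : GroupAlg m => A.coeff σ) hexp
  beta_reduce at hcoeff
  rw [coeff_classExpansion c m σ ρ.parts hparts 0 hσ (by rw [ρ.parts_sum, add_zero]), zero_add,
    Finset.sum_range_one, Nat.choose_self, Nat.cast_one, mul_one,
    congr_of_parts_eq c _ ρ (by simp [addOnes])] at hcoeff
  have hcard := sum_map_sub_one_add_card ρ.parts fun l hl => (hparts l hl).trans' (by norm_num)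
  rw [ρ.parts_sum] at hcard
  have hlen : len ρ = Multiset.card ρ.parts := rfl
  -- Needed for the exponent `len ρ - 1`; an empty `ρ` would have weight `0 < k`.
  have hlen0 : len ρ ≠ 0 := fun h0 => by
    rw [hlen, Multiset.card_eq_zero] at h0
    have := ρ.parts_sum
    rw [h0, Multiset.sum_zero] at this
    omega
  have htop := coeff_reflLength_ratioProd m le_rfl k σ (fun i hi => absurd i.2 (by omega))
    (by rw [reflLength, hσ]; omega)
  rw [← one_sub_z_smul_evalJM_rowPoly m hk, MonoidAlgebra.coeff_smul_apply, hcoeff, smul_eq_mul,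
    permWeight, hσ, prod_map_cycleWeight _ hparts, ← hlen] at htop
  apply mul_left_cancel₀ one_sub_z_ne_zero
  rw [htop, ← mul_assoc, ← pow_succ', Nat.sub_add_cancel (Nat.one_le_iff_ne_zero.mpr hlen0)]

end ClassExpansion

end HallLittlewoodClass

end

theorem proposition8p4 (k : ℕ) (hk : 1 ≤ k) :
    (∃ c : (m : ℕ) → m.Partition → ℂ[X], HallLittlewoodClass.IsClassExpansion k c) ∧
    ∀ c : (m : ℕ) → m.Partition → ℂ[X], HallLittlewoodClass.IsClassExpansion k c →
      ∀ (m : ℕ) (ρ : m.Partition),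
        (m : ℤ) - (HallLittlewoodClass.len ρ : ℤ) = (k : ℤ) →
        HallLittlewoodClass.mult 1 ρ = 0 →
        c m ρ = (1 - HallLittlewoodClass.z) ^ (HallLittlewoodClass.len ρ - 1) *
          (ρ.parts.map (fun r => HallLittlewoodClass.genCatalan (r - 1))).prod :=
  ⟨HallLittlewoodClass.exists_isClassExpansion hk, fun _ hc _ ρ hρ h1 =>
    hc.eq_of_mult_one_eq_zero hk ρ (by omega) h1⟩
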